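/- Let $\Bbbk$ be a field of characteristic zero. Let $W_{\ge -1}=\Bbbk[t]\partial$, $\partial=\frac{d}{dt}$, be the Lie algebra of derivations of $\Bbbk[t]$, with bracket $[f\partial,g\partial]=(fg'-f'g)\partial$ and basis $e_i=t^{i+1}\partial$ ($i\ge -1$). For $n\ge 0$ let $W_{\ge n}$ be the span of the $e_i$ with $i\ge n$, let $\mathfrak g_n=W_{\ge 0}/W_{\ge n}$, and let $v_i=e_i+W_{\ge n}\in\mathfrak g_n$ for $0\le i\le n-1$. Let $A_1=\Bbbk\langle t,\partial\rangle/(\partial t-t\partial-1)$ be the first Weyl algebra and $T_n=A_1\otimes_{\Bbbk}U(\mathfrak g_n)$. Let $\Psi_n:U(W_{\ge -1})\to T_n$ be the algebra homomorphism induced by the Lie algebra homomorphism $$f\partial\longmapsto f\partial+\sum_{i=0}^{n-1}\frac{f^{(i+1)}}{(i+1)!}\,v_i ,$$ and let $B_n=\Psi_n(U(W_{\ge -1}))\subseteq T_n$. For integers $m\ge 0$, $s\ge -1$, $k\ge m-1$ put $$\Omega^{(m)}_{k,s}=\sum_{i=0}^m(-1)^i\binom mi e_{k-i}e_{s+i}\in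 U(W_{\ge -1}).$$ Theorem. Let $n\ge 2$. Then: 1. $\Psi_n(\Omega^{(2n)}_{2n-1,-1})\in\Bbbk^\times v_{n-1}^2$. 2. The left ideal $T_nv_{n-1}^2$ of $T_n$ is equal to the two-sided ideal of $T_n$ generated by $v_{n-1}^2$, and $T_nv_{n-1}^2\subseteq B_n$. 3. $T_nv_{n-1}^2$ is a principal two-sided ideal of $B_n$: it is the two-sided ideal $B_nv_{n-1}^2B_n$ generated by $v_{n-1}^2$. 4. $T_nv_{n-1}^2$ is not finitely generated as a left ideal of $B_n$, and not finitely generated as a right ideal of $B_n$. -/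

import Mathlib

noncomputable section

open scoped TensorProduct Polynomial

namespace OrbitHom

attribute [local instance 100] LieRing.ofAssociativeRing

variable (k : Type*) [Field k]

/-- The one-sided Witt algebra `W_{≥ -1}`, the Lie algebra of derivations of `k[t]`
(here `X` is the variable `t`); the bracket is the commutator of derivations. -/
abbrev Witt : Type _ := Derivation k k[X] k[X]

variable {k}

/-- The derivation `f ∂`, where `∂ = d/dt`. -/
def vf (f : k[X]) : Witt k := Polynomial.mkDerivation k f

theorem witt_apply (D : Witt k) (p : k[X]) :
    D p = Polynomial.derivative p * D Polynomial.X := by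
  have h : D = Polynomial.mkDerivation k (D Polynomial.X) := by
    apply Polynomial.derivation_ext
    simp
  conv_lhs => rw [h]
  rw [Polynomial.mkDerivation_apply, smul_eq_mul]

theorem vf_X (f : k[X]) : vf f Polynomial.X = f := by simp [vf]

theorem vf_apply_X (D : Witt k) : vf (D Polynomial.X) = D := by
  apply Polynomial.derivation_ext
  simp [vf_X]

theorem lie_apply_X (D E : Witt k) :
    ⁅D, E⁆ Polynomial.X = D Polynomial.X * Polynomial.derivative (E Polynomial.X)
      - Polynomial.derivative (D Polynomial.X) * E Polynomial.X := by
  rw [Derivation.commutator_apply, witt_apply D (E _), witt_apply E (D _)]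
  ring

/-- The Lie bracket in terms of polynomials: `[f ∂, g ∂] = (f g' - f' g) ∂`. -/
theorem lie_vf (f g : k[X]) :
    ⁅vf f, vf g⁆ = vf (f * Polynomial.derivative g - Polynomial.derivative f * g) := by
  rw [← vf_apply_X ⁅vf f, vf g⁆, lie_apply_X, vf_X, vf_X]

variable (k) in
/-- The basis vectors `e_i = t^{i+1} ∂` of `W_{≥ -1}`, for integers `i ≥ -1`. -/
def e (i : ℤ) : Witt k := vf (Polynomial.X ^ (i + 1).toNat)

theorem mem_span_e (n : ℤ) (D : Witt k) :
    D ∈ Submodule.span k {D : Witt k | ∃ i : ℤ, n ≤ i ∧ -1 ≤ i ∧ D = e k i} ↔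
      (Polynomial.X : k[X]) ^ (n + 1).toNat ∣ D Polynomial.X := by
  constructor
  · intro h
    induction h using Submodule.span_induction with
    | mem D hD =>
      obtain ⟨i, hi, -, rfl⟩ := hD
      rw [e, vf_X]
      exact pow_dvd_pow _ (by omega)
    | zero => simp
    | add D E _ _ hD hE => simpa using dvd_add hD hE
    | smul c D _ hD => simpa [Polynomial.smul_eq_C_mul] using Dvd.dvd.mul_left hD _
  · rintro ⟨p, hp⟩
    rw [← vf_apply_X D, hp, p.as_sum_range_C_mul_X_pow, Finset.mul_sum]
    unfold vf
    rw [map_sum]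
    refine Submodule.sum_mem _ fun j _ => ?_
    rw [mul_left_comm, ← pow_add, ← Polynomial.smul_eq_C_mul, map_smul]
    refine Submodule.smul_mem _ _ (Submodule.subset_span ?_)
    refine ⟨((n + 1).toNat + j : ℕ) - 1, by omega, by omega, ?_⟩
    have h : ((((n + 1).toNat + j : ℕ) : ℤ) - 1 + 1).toNat = (n + 1).toNat + j := by omega
    rw [e, h]
    rfl

variable (k) in
/-- The Lie subalgebra `W_{≥ n}` of `W_{≥ -1}`, the linear span of the `e_i` with `i ≥ n`
(and `i ≥ -1`). -/
def wittGE (n : ℤ) : LieSubalgebra k (Witt k) where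
  toSubmodule := Submodule.span k {D : Witt k | ∃ i : ℤ, n ≤ i ∧ -1 ≤ i ∧ D = e k i}
  lie_mem' := by
    intro D E hD hE
    simp only [AddSubsemigroup.mem_carrier, AddSubmonoid.mem_toSubsemigroup,
      Submodule.mem_toAddSubmonoid, mem_span_e] at hD hE ⊢
    rw [lie_apply_X]
    obtain ⟨p, hp⟩ := hD
    obtain ⟨q, hq⟩ := hE
    rw [hp, hq]
    refine ⟨Polynomial.X ^ (n + 1).toNat * (p * Polynomial.derivative q
      - Polynomial.derivative p * q), ?_⟩
    simp only [Polynomial.derivative_mul]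
    ring

theorem mem_wittGE (n : ℤ) (D : Witt k) :
    D ∈ wittGE k n ↔ (Polynomial.X : k[X]) ^ (n + 1).toNat ∣ D Polynomial.X :=
  mem_span_e n D

theorem e_mem_wittGE {n i : ℤ} (h : n ≤ i) : e k i ∈ wittGE k n := by
  rw [mem_wittGE, e, vf_X]
  exact pow_dvd_pow _ (by omega)

variable (k) in
/-- `W_{≥ n}` as a Lie ideal of `W_{≥ 0}`, for `n ≥ 0`. -/
def wittIdeal (n : ℕ) : LieIdeal k (wittGE k 0) where
  toSubmodule := (wittGE k n).toSubmodule.comap (wittGE k 0).toSubmodule.subtype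
  lie_mem := by
    rintro ⟨D, hD⟩ ⟨E, hE'⟩ hE
    have hE : E ∈ wittGE k n := hE
    change ⁅D, E⁆ ∈ wittGE k n
    rw [mem_wittGE] at hD hE ⊢
    rw [lie_apply_X]
    obtain ⟨p, hp⟩ := hD
    obtain ⟨q, hq⟩ := hE
    have h1 : ((n : ℤ) + 1).toNat = n + 1 := by omega
    have h0 : ((0 : ℤ) + 1).toNat = 1 := by omega
    rw [hp, hq, h1, h0]
    refine ⟨p * (((n + 1 : ℕ) : k[X]) * q + Polynomial.X * Polynomial.derivative q)
      - Polynomial.derivative (Polynomial.X * p) * q, ?_⟩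
    simp only [Polynomial.derivative_mul, Polynomial.derivative_X_pow]
    simp
    ring

theorem mem_wittIdeal (n : ℕ) (D : wittGE k 0) :
    D ∈ wittIdeal k n ↔ (D : Witt k) ∈ wittGE k n := Iff.rfl

variable (k) in
/-- The finite-dimensional Lie algebra `𝔤_n = W_{≥ 0} / W_{≥ n}`. -/
abbrev g (n : ℕ) : Type _ := wittGE k 0 ⧸ wittIdeal k n

variable (k) in
/-- The elements `v_i = e_i + W_{≥ n}` of `𝔤_n`, which vanish for `i ≥ n`. -/
def v (n i : ℕ) : g k n :=
  LieSubmodule.Quotient.mk (N := wittIdeal k n)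
    (⟨e k i, e_mem_wittGE (Int.natCast_nonneg i)⟩ : wittGE k 0)

theorem v_eq_zero {n i : ℕ} (h : n ≤ i) : v k n i = 0 := by
  rw [v, LieSubmodule.Quotient.mk_eq_zero', mem_wittIdeal]
  exact e_mem_wittGE (by exact_mod_cast h)

theorem lie_e (i j : ℕ) : ⁅e k i, e k j⁆ = ((j : k) - i) • e k ((i + j : ℕ) : ℤ) := by
  have h (a : ℕ) : ((a : ℤ) + 1).toNat = a + 1 := by omega
  rw [e, e, e, lie_vf, h, h, h, vf, vf, ← map_smul]
  congr 1
  simp only [Polynomial.derivative_X_pow, Polynomial.smul_eq_C_mul]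
  simp
  ring

theorem lie_v (n i j : ℕ) : ⁅v k n i, v k n j⁆ = ((j : k) - i) • v k n (i + j) := by
  rw [v, v, v, ← LieSubmodule.Quotient.mk_bracket]
  have h : ⁅(⟨e k i, e_mem_wittGE (Int.natCast_nonneg i)⟩ : wittGE k 0),
      (⟨e k j, e_mem_wittGE (Int.natCast_nonneg j)⟩ : wittGE k 0)⁆
      = ((j : k) - i) • ⟨e k ((i + j : ℕ) : ℤ), e_mem_wittGE (Int.natCast_nonneg _)⟩ :=
    Subtype.ext (lie_e i j)
  rw [h]
  rfl

variable (k) in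
/-- The defining relation `∂ t - t ∂ = 1` of the Weyl algebra, on the free algebra on two letters,
letter `0` standing for `t` and letter `1` for `∂`. -/
inductive WeylRel : FreeAlgebra k (Fin 2) → FreeAlgebra k (Fin 2) → Prop
  | comm : WeylRel (FreeAlgebra.ι k 1 * FreeAlgebra.ι k 0 - FreeAlgebra.ι k 0 * FreeAlgebra.ι k 1) 1

variable (k) in
/-- The first Weyl algebra `A_1 = k⟨t, ∂⟩ / (∂ t - t ∂ - 1)`. -/
def Weyl : Type _ := RingQuot (WeylRel k)

instance : Ring (Weyl k) := inferInstanceAs (Ring (RingQuot (WeylRel k)))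

instance : Algebra k (Weyl k) := inferInstanceAs (Algebra k (RingQuot (WeylRel k)))

variable (k) in
/-- The quotient map from the free algebra on two letters to the Weyl algebra. -/
def weylMk : FreeAlgebra k (Fin 2) →ₐ[k] Weyl k := RingQuot.mkAlgHom k (WeylRel k)

variable (k) in
/-- The generator `t` of the Weyl algebra. -/
def weylT : Weyl k := weylMk k (FreeAlgebra.ι k 0)

variable (k) in
/-- The generator `∂` of the Weyl algebra. -/
def weylD : Weyl k := weylMk k (FreeAlgebra.ι k 1)

theorem weyl_comm : weylD k * weylT k - weylT k * weylD k = 1 := by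
  have h : weylMk k _ = weylMk k _ := RingQuot.mkAlgHom_rel k (WeylRel.comm (k := k))
  simpa only [weylD, weylT, map_sub, map_mul, map_one] using h

/-- The element `f(t)` of the Weyl algebra. -/
def weylPoly (f : k[X]) : Weyl k := Polynomial.aeval (weylT k) f

theorem weylD_mul_poly (f : k[X]) :
    weylD k * weylPoly f = weylPoly f * weylD k + weylPoly (Polynomial.derivative f) := by
  have h1 : weylD k * weylT k = weylT k * weylD k + 1 := by rw [← weyl_comm (k := k)]; abel
  unfold weylPoly
  induction f using Polynomial.induction_on' with
  | add p q hp hq => simp only [map_add, mul_add, add_mul, hp, hq]; abel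
  | monomial m a =>
    rw [← Polynomial.C_mul_X_pow_eq_monomial, ← Polynomial.smul_eq_C_mul]
    simp only [map_smul, mul_smul_comm, smul_mul_assoc, ← smul_add]
    congr 1
    induction m with
    | zero => simp
    | succ m ih =>
      rw [pow_succ, map_mul, ← mul_assoc, ih, Polynomial.derivative_mul, map_add, map_mul]
      simp only [Polynomial.aeval_X, Polynomial.derivative_X, mul_one, add_mul]
      rw [mul_assoc, h1, mul_add, mul_assoc]
      simp only [mul_one]
      abel

variable (k) in
/-- The algebra `T_n = A_1 ⊗ U(𝔤_n)`. -/
abbrev T (n : ℕ) : Type _ := Weyl k ⊗[k] UniversalEnvelopingAlgebra k (g k n)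

variable (k) in
/-- The element `v_i = 1 ⊗ v_i` of `T_n`. -/
def vT (n i : ℕ) : T k n := 1 ⊗ₜ[k] UniversalEnvelopingAlgebra.ι k (v k n i)

variable (k) in
/-- The element `∂ = ∂ ⊗ 1` of `T_n`. -/
def dT (n : ℕ) : T k n := weylD k ⊗ₜ[k] 1

/-- The element `f(t) = f(t) ⊗ 1` of `T_n`. -/
def polyT (n : ℕ) (f : k[X]) : T k n := weylPoly f ⊗ₜ[k] 1

theorem polyT_add (n : ℕ) (f h : k[X]) : polyT n (f + h) = polyT n f + polyT n h := by
  simp [polyT, weylPoly, TensorProduct.add_tmul]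

theorem polyT_smul (n : ℕ) (c : k) (f : k[X]) : polyT n (c • f) = c • polyT n f := by
  simp [polyT, weylPoly, TensorProduct.smul_tmul']

theorem polyT_mul (n : ℕ) (f h : k[X]) : polyT n (f * h) = polyT n f * polyT n h := by
  simp [polyT, weylPoly]

theorem polyT_comm (n : ℕ) (f h : k[X]) : polyT n f * polyT n h = polyT n h * polyT n f := by
  rw [← polyT_mul, mul_comm, polyT_mul]

theorem dT_mul_polyT (n : ℕ) (f : k[X]) :
    dT k n * polyT n f = polyT n f * dT k n + polyT n (Polynomial.derivative f) := by
  simp [dT, polyT, weylD_mul_poly, TensorProduct.add_tmul]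

theorem vT_mul_polyT (n i : ℕ) (f : k[X]) : vT k n i * polyT n f = polyT n f * vT k n i := by
  simp [vT, polyT]

theorem vT_mul_dT (n i : ℕ) : vT k n i * dT k n = dT k n * vT k n i := by
  simp [vT, dT]

theorem vT_comm (n i j : ℕ) :
    vT k n i * vT k n j = vT k n j * vT k n i + ((j : k) - i) • vT k n (i + j) := by
  have h := (UniversalEnvelopingAlgebra.ι k).map_lie (v k n i) (v k n j)
  rw [lie_v, map_smul, LieRing.of_associative_ring_bracket] at h
  simp only [vT, Algebra.TensorProduct.tmul_mul_tmul, mul_one, ← TensorProduct.tmul_smul]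
  rw [h, ← TensorProduct.tmul_add]
  congr 1
  abel

theorem vT_eq_zero {n i : ℕ} (h : n ≤ i) : vT k n i = 0 := by
  simp [vT, v_eq_zero h]

/-- The linear map `f ∂ ↦ f ∂ + ∑_{i < n} f^{(i+1)} / (i+1)! v_i` from `W_{≥ -1}` to `T_n`. -/
def psiLinear (k : Type*) [Field k] (n : ℕ) : Witt k →ₗ[k] T k n where
  toFun D := polyT n (D Polynomial.X) * dT k n
    + ∑ i ∈ Finset.range n,
        polyT n (((i + 1).factorial : k)⁻¹ • Polynomial.derivative^[i + 1] (D Polynomial.X))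
          * vT k n i
  map_add' D E := by
    simp only [Derivation.add_apply, polyT_add, iterate_map_add, smul_add,
      add_mul, Finset.sum_add_distrib]
    exact add_add_add_comm _ _ _ _
  map_smul' c D := by
    simp only [Derivation.smul_apply, polyT_smul, Polynomial.iterate_derivative_smul,
      smul_mul_assoc, RingHom.id_apply, smul_add, Finset.smul_sum]
    congr 1
    exact Finset.sum_congr rfl fun i _ => smul_comm _ _ _

theorem hasseDeriv_eq [CharZero k] (i : ℕ) (f : k[X]) :
    ((i.factorial : k))⁻¹ • Polynomial.derivative^[i] f = Polynomial.hasseDeriv i f := by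
  rw [← Polynomial.factorial_smul_hasseDeriv, LinearMap.smul_apply, ← Nat.cast_smul_eq_nsmul k,
    smul_smul, inv_mul_cancel₀ (by exact_mod_cast i.factorial_ne_zero), one_smul]

theorem psiLinear_apply [CharZero k] (n : ℕ) (D : Witt k) :
    psiLinear k n D = polyT n (D Polynomial.X) * dT k n
      + ∑ i ∈ Finset.range n, polyT n (Polynomial.hasseDeriv (i + 1) (D Polynomial.X))
          * vT k n i := by
  simp only [← hasseDeriv_eq]
  rfl

theorem derivative_hasseDeriv (i : ℕ) (f : k[X]) :
    Polynomial.derivative (Polynomial.hasseDeriv i f)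
      = ((i : k) + 1) • Polynomial.hasseDeriv (i + 1) f := by
  have h := congrArg (fun l => l f) (Polynomial.hasseDeriv_comp (R := k) 1 i)
  simp only [LinearMap.comp_apply, Polynomial.hasseDeriv_one, LinearMap.smul_apply,
    Nat.choose_one_right, ← Nat.cast_smul_eq_nsmul k] at h
  rw [h, add_comm 1 i]
  push_cast
  rfl

theorem hasseDeriv_derivative (i : ℕ) (f : k[X]) :
    Polynomial.hasseDeriv i (Polynomial.derivative f)
      = ((i : k) + 1) • Polynomial.hasseDeriv (i + 1) f := by
  have h := congrArg (fun l => l f) (Polynomial.hasseDeriv_comp (R := k) i 1)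
  simp only [LinearMap.comp_apply, Polynomial.hasseDeriv_one, LinearMap.smul_apply,
    Nat.choose_succ_self_right, ← Nat.cast_smul_eq_nsmul k] at h
  rw [h]
  push_cast
  rfl

theorem hasseDeriv_bracket (m : ℕ) (p q : k[X]) :
    Polynomial.hasseDeriv (m + 1) (p * Polynomial.derivative q - Polynomial.derivative p * q)
      = ((m : k) + 2) • (p * Polynomial.hasseDeriv (m + 2) q)
        - ((m : k) + 2) • (Polynomial.hasseDeriv (m + 2) p * q)
        + ∑ a ∈ Finset.HasAntidiagonal.antidiagonal m, ((a.2 : k) - a.1) •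
            (Polynomial.hasseDeriv (a.1 + 1) p * Polynomial.hasseDeriv (a.2 + 1) q) := by
  rw [map_sub, Polynomial.hasseDeriv_mul, Polynomial.hasseDeriv_mul,
    Finset.Nat.sum_antidiagonal_succ, Finset.Nat.sum_antidiagonal_succ']
  simp only [hasseDeriv_derivative, Polynomial.hasseDeriv_zero', mul_smul_comm, smul_mul_assoc]
  rw [add_sub_add_comm, ← Finset.sum_sub_distrib]
  congr 1
  · push_cast
    rw [add_assoc, one_add_one_eq_two]
  · refine Finset.sum_congr rfl fun a _ => ?_
    rw [← sub_smul]
    congr 1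
    ring

theorem polyT_sub (n : ℕ) (f h : k[X]) : polyT n (f - h) = polyT n f - polyT n h := by
  simp [polyT, weylPoly, TensorProduct.sub_tmul]

theorem polyT_sum {ι : Type*} (n : ℕ) (s : Finset ι) (f : ι → k[X]) :
    polyT n (∑ i ∈ s, f i) = ∑ i ∈ s, polyT n (f i) := by
  simp [polyT, weylPoly, TensorProduct.sum_tmul]

theorem comm_dd (n : ℕ) (p q : k[X]) :
    polyT n p * dT k n * (polyT n q * dT k n) - polyT n q * dT k n * (polyT n p * dT k n)
      = polyT n (p * Polynomial.derivative q - Polynomial.derivative p * q) * dT k n := by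
  have h (p q : k[X]) : polyT n p * dT k n * (polyT n q * dT k n)
      = polyT n p * polyT n q * (dT k n * dT k n)
        + polyT n (p * Polynomial.derivative q) * dT k n := by
    rw [mul_assoc, ← mul_assoc (dT k n), dT_mul_polyT, polyT_mul]
    simp only [mul_add, add_mul, mul_assoc]
  rw [h, h, polyT_comm n q p, polyT_sub, sub_mul, mul_comm q]
  abel

theorem comm_dv (n j : ℕ) (p q : k[X]) :
    polyT n p * dT k n * (polyT n q * vT k n j) - polyT n q * vT k n j * (polyT n p * dT k n)
      = polyT n (p * Polynomial.derivative q) * vT k n j := by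
  have h1 : polyT n p * dT k n * (polyT n q * vT k n j)
      = polyT n p * polyT n q * (dT k n * vT k n j)
        + polyT n (p * Polynomial.derivative q) * vT k n j := by
    rw [mul_assoc, ← mul_assoc (dT k n), dT_mul_polyT, polyT_mul]
    simp only [mul_add, add_mul, mul_assoc]
  have h2 : polyT n q * vT k n j * (polyT n p * dT k n)
      = polyT n p * polyT n q * (dT k n * vT k n j) := by
    rw [mul_assoc, ← mul_assoc (vT k n j), vT_mul_polyT, mul_assoc (polyT n p), vT_mul_dT,
      ← mul_assoc, polyT_comm]
  rw [h1, h2, add_sub_cancel_left]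

theorem comm_vv (n i j : ℕ) (p q : k[X]) :
    polyT n p * vT k n i * (polyT n q * vT k n j) - polyT n q * vT k n j * (polyT n p * vT k n i)
      = polyT n (((j : k) - i) • (p * q)) * vT k n (i + j) := by
  have h (p q : k[X]) (i j : ℕ) : polyT n p * vT k n i * (polyT n q * vT k n j)
      = polyT n p * polyT n q * (vT k n i * vT k n j) := by
    rw [mul_assoc, ← mul_assoc (vT k n i), vT_mul_polyT]
    simp only [mul_assoc]
  rw [h, h, polyT_comm n q p, ← mul_sub, vT_comm n i j, add_sub_cancel_left, polyT_smul,
    polyT_mul, mul_smul_comm, smul_mul_assoc]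

theorem sum_square_eq {M : Type*} [AddCommMonoid M] (n : ℕ) (φ : ℕ → ℕ → M)
    (h : ∀ i j, n ≤ i + j → φ i j = 0) :
    ∑ i ∈ Finset.range n, ∑ j ∈ Finset.range n, φ i j
      = ∑ m ∈ Finset.range n, ∑ a ∈ Finset.HasAntidiagonal.antidiagonal m, φ a.1 a.2 := by
  rw [← Finset.sum_product', Finset.sum_sigma']
  symm
  refine Finset.sum_bij_ne_zero (fun a _ _ => a.2) ?_ ?_ ?_ ?_
  · rintro ⟨m, a⟩ h1 _
    simp only [Finset.mem_sigma, Finset.mem_range, Finset.mem_product,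
      Finset.HasAntidiagonal.mem_antidiagonal] at h1 ⊢
    omega
  · rintro ⟨m, a⟩ h1 _ ⟨m', a'⟩ h2 _ h3
    simp only [Finset.mem_sigma, Finset.mem_range, Finset.HasAntidiagonal.mem_antidiagonal] at h1 h2 h3
    obtain ⟨_, rfl⟩ := h1
    obtain ⟨_, rfl⟩ := h2
    rw [h3]
  · rintro ⟨i, j⟩ _ h2
    refine ⟨⟨i + j, (i, j)⟩, ?_, h2, rfl⟩
    simp only [Finset.mem_sigma, Finset.mem_range, Finset.HasAntidiagonal.mem_antidiagonal, and_true]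
    by_contra hlt
    exact h2 (h i j (by omega))
  · rintro ⟨m, a⟩ _ _
    rfl

/-- The Lie algebra homomorphism `ψ_n : W_{≥ -1} → T_n`,
`f ∂ ↦ f ∂ + ∑_{i < n} f^{(i+1)} / (i+1)! v_i`. -/
def psi (k : Type*) [Field k] [CharZero k] (n : ℕ) : Witt k →ₗ⁅k⁆ T k n where
  toLinearMap := psiLinear k n
  map_lie' := by
    intro D E
    set p := D Polynomial.X with hp
    set q := E Polynomial.X with hq
    change psiLinear k n ⁅D, E⁆ = ⁅psiLinear k n D, psiLinear k n E⁆
    rw [LieRing.of_associative_ring_bracket, psiLinear_apply, psiLinear_apply, psiLinear_apply,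
      lie_apply_X, ← hp, ← hq, ← comm_dd]
    simp only [add_mul, mul_add, Finset.sum_mul, Finset.mul_sum, Finset.sum_add_distrib]
    rw [Finset.sum_comm (f := fun j i => polyT n (Polynomial.hasseDeriv (i + 1) p) * vT k n i *
      (polyT n (Polynomial.hasseDeriv (j + 1) q) * vT k n j))]
    have hvv : ∑ i ∈ Finset.range n, ∑ j ∈ Finset.range n,
        (polyT n (Polynomial.hasseDeriv (i + 1) p) * vT k n i *
            (polyT n (Polynomial.hasseDeriv (j + 1) q) * vT k n j)
          - polyT n (Polynomial.hasseDeriv (j + 1) q) * vT k n j *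
            (polyT n (Polynomial.hasseDeriv (i + 1) p) * vT k n i))
        = ∑ m ∈ Finset.range n, polyT n (∑ a ∈ Finset.HasAntidiagonal.antidiagonal m,
            ((a.2 : k) - a.1) • (Polynomial.hasseDeriv (a.1 + 1) p
              * Polynomial.hasseDeriv (a.2 + 1) q)) * vT k n m := by
      simp only [comm_vv]
      rw [sum_square_eq]
      · refine Finset.sum_congr rfl fun m _ => ?_
        rw [polyT_sum, Finset.sum_mul]
        refine Finset.sum_congr rfl fun a ha => ?_
        rw [Finset.HasAntidiagonal.mem_antidiagonal.1 ha]
      · intro i j hij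
        rw [vT_eq_zero hij, mul_zero]
    have hdv (p q : k[X]) : ∑ j ∈ Finset.range n,
        (polyT n p * dT k n * (polyT n (Polynomial.hasseDeriv (j + 1) q) * vT k n j)
          - polyT n (Polynomial.hasseDeriv (j + 1) q) * vT k n j * (polyT n p * dT k n))
        = ∑ m ∈ Finset.range n,
          polyT n (((m : k) + 2) • (p * Polynomial.hasseDeriv (m + 2) q)) * vT k n m := by
      refine Finset.sum_congr rfl fun j _ => ?_
      rw [comm_dv, derivative_hasseDeriv, mul_smul_comm]
      push_cast
      rw [add_assoc (j : k), one_add_one_eq_two]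
    have h1 := hdv p q
    have h2 := hdv q p
    simp only [Finset.sum_sub_distrib] at hvv h1 h2
    simp only [hasseDeriv_bracket, polyT_add, polyT_sub, add_mul, sub_mul,
      Finset.sum_add_distrib, Finset.sum_sub_distrib]
    rw [← hvv, ← h1]
    simp only [mul_comm _ q]
    rw [← h2]
    abel

/-- The orbit homomorphism `Ψ_n : U(W_{≥ -1}) → T_n`, the algebra homomorphism induced by `ψ_n`. -/
def Psi (k : Type*) [Field k] [CharZero k] (n : ℕ) :
    UniversalEnvelopingAlgebra k (Witt k) →ₐ[k] T k n :=
  UniversalEnvelopingAlgebra.lift k (psi k n)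

/-- The image `B_n` of the orbit homomorphism, a subalgebra of `T_n`. -/
abbrev B (k : Type*) [Field k] [CharZero k] (n : ℕ) : Subalgebra k (T k n) := (Psi k n).range

/-- The differentiator `Ω^{(m)}_{r,s} = ∑_i (-1)^i (m choose i) e_{r-i} e_{s+i}` in `U(W_{≥ -1})`,
for integers `m ≥ 0`, `s ≥ -1` and `r ≥ m - 1`. -/
def differentiator (k : Type*) [Field k] (m : ℕ) (r s : ℤ) :
    UniversalEnvelopingAlgebra k (Witt k) :=
  ∑ i ∈ Finset.range (m + 1), ((-1 : k) ^ i * (m.choose i : k)) •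
    (UniversalEnvelopingAlgebra.ι k (e k (r - i)) * UniversalEnvelopingAlgebra.ι k (e k (s + i)))

end OrbitHom

end

/-!
Write `w = v_{n-1}^2` throughout.

The products `Ψ_n(e_{2n-1-i}) Ψ_n(e_{i-1})` are combinations of fixed elements of `T_n` with
binomial coefficients `(2n-i choose a) (i choose b)`. Alternating summation
against `(2n choose i)` kills such a coefficient unless `a + b ≥ 2n`
(`sum_alternating_choose_mul_choose_mul_choose`), and only the term `v_{n-1} v_{n-1}`, with
`a = b = n`, reaches this bound; `n ≥ 2` keeps the terms containing `∂` below it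
(`Psi_differentiator`).

Since `[v_0, w] = 2 (n-1) w` and `w` commutes with the other generators, `w` is normal in `T_n`,
so `T_n w = w T_n` is two-sided (`exists_sq_mul_eq`, `exists_mul_sq_eq`).

For `T_n w ⊆ B_n w B_n` (`mul_sq_mem`), commutators of `w` with `Ψ_n(e_i)` are nonzero multiples of
`t^i w`, so `B_n w B_n` contains all `t^j w`. If it contains `t^j x w` for all `j`, then left
multiplication by `Ψ_n(e_p)`, whose leading term is `v_p`, shows by induction on `p` that it also
contains all `t^j v_p x w`; as `t`, `∂` and the `v_p` generate `T_n`, it contains `T_n w`.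

For the failure of finite generation, specialize `v_0` to a scalar `c` and the other `v_i` to `0`.
This maps `T_n` onto `A_1`, and `f ∂ + ∑ f^{(i+1)}/(i+1)! v_i` to `f ∂ + c f'`. For `c = 1` this is
`∂ f`, so `B_n` lands in `k + ∂ A_1`, which acts on the infinite-dimensional space `A_1 / ∂ A_1`
from the left by scalars; for `c = 0` it lands in `k + A_1 ∂`, which acts by scalars on
`A_1 / A_1 ∂` from the right. To transport this to `T_n w` one needs the linear maps
`x w ↦ (x mod v)` and `w x ↦ (x mod v)` to be well defined. This is where one would quote the
Poincaré–Birkhoff–Witt theorem; instead both come from matrix coefficients of the tensor square of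
the adjoint representation of `𝔤_n`, twisted by a character, on which `w` acts as a nonzero operator
of rank one (`twistedAction_sq`, `exists_functionals`).
-/

noncomputable section

open scoped TensorProduct Polynomial

namespace OrbitHom

attribute [local instance 100] LieRing.ofAssociativeRing

variable {k : Type*} [Field k]

/-! ### The image of the differentiator -/

/-- The `m`-th finite difference, `m = a + b + c`, of the polynomial `(m - i choose a) (i choose b)`
in `i`, which has degree `a + b`. -/
theorem sum_alternating_choose_mul_choose_mul_choose (R : Type*) [CommRing R] (a b c : ℕ) :
    ∑ i ∈ Finset.range (a + b + c + 1), ((-1 : R) ^ i * ((a + b + c).choose i : R)) *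
        (((a + b + c - i).choose a : R) * (i.choose b : R))
      = if c = 0 then (-1) ^ b * ((a + b).choose b : R) else 0 := by
  -- Both sides are the multinomial coefficient `m! / (a! b! j! (c - j)!)`, or zero for `j > c`.
  have hN (j : ℕ) : (a + b + c).choose (b + j) * ((a + b + c - (b + j)).choose a *
      (b + j).choose b) = (a + b + c).choose b * (a + c).choose a * c.choose j := by
    have h1 := Nat.choose_mul (n := a + b + c) (k := b + j) (s := b) (by omega)
    have e1 : a + b + c - b = a + c := by omega
    have e2 : b + j - b = j := by omega
    have e3 : a + b + c - (b + j) = a + c - j := by omega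
    rw [e1, e2] at h1
    rw [e3, mul_left_comm, h1, mul_assoc, mul_left_comm]
    congr 1
    rcases le_or_gt j c with hj | hj
    · have h2 := Nat.choose_mul (n := a + c) (k := a + c - j) (s := a) (by omega)
      rw [Nat.choose_symm (by omega), show a + c - a = c by omega,
        show a + c - j - a = c - j by omega, Nat.choose_symm hj] at h2
      rw [mul_comm, h2]
    · rw [Nat.choose_eq_zero_of_lt hj, mul_zero]
      rcases le_or_gt j (a + c) with hj' | hj'
      · rw [Nat.choose_eq_zero_of_lt (show a + c - j < a by omega), zero_mul]
      · rw [Nat.choose_eq_zero_of_lt hj', mul_zero]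
  have hlow : ∀ i ∈ Finset.range b, ((-1 : R) ^ i * ((a + b + c).choose i : R)) *
      (((a + b + c - i).choose a : R) * (i.choose b : R)) = 0 := fun i hi => by
    rw [Nat.choose_eq_zero_of_lt (Finset.mem_range.1 hi)]
    simp
  have hhigh : ∀ j ∈ Finset.range a, ((-1 : R) ^ (b + (c + 1 + j)) *
      ((a + b + c).choose (b + (c + 1 + j)) : R)) * (((a + b + c - (b + (c + 1 + j))).choose a : R)
        * ((b + (c + 1 + j)).choose b : R)) = 0 := fun j hj => by
    have := Finset.mem_range.1 hj
    rw [Nat.choose_eq_zero_of_lt (show a + b + c - (b + (c + 1 + j)) < a by omega)]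
    simp
  have hmid : ∀ j, ((-1 : R) ^ (b + j) * ((a + b + c).choose (b + j) : R)) *
      (((a + b + c - (b + j)).choose a : R) * ((b + j).choose b : R))
      = (-1) ^ b * ((a + b + c).choose b * (a + c).choose a : R) *
        (((-1) ^ j * (c.choose j : ℤ) : ℤ) : R) := fun j => by
    have h := congrArg (Nat.cast (R := R)) (hN j)
    push_cast at h ⊢
    rw [pow_add]
    linear_combination (-1) ^ b * (-1) ^ j * h
  rw [show a + b + c + 1 = b + (c + 1 + a) by omega, Finset.sum_range_add,
    Finset.sum_eq_zero hlow, zero_add, Finset.sum_range_add, Finset.sum_eq_zero hhigh, add_zero,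
    Finset.sum_congr rfl fun j _ => hmid j, ← Finset.mul_sum, ← Int.cast_sum,
    Int.alternating_sum_range_choose]
  split_ifs with hc
  · simp [hc]
  · simp

/-- The value `Ψ_n(e_{m-1})`. Where the exponent `m - (l + 1)` is truncated, the binomial
coefficient vanishes. -/
theorem psi_vf_X_pow [CharZero k] (n m : ℕ) :
    psi k n (vf (Polynomial.X ^ m)) = polyT n (Polynomial.X ^ m) * dT k n
      + ∑ l ∈ Finset.range n, (m.choose (l + 1) : k) •
          (polyT n (Polynomial.X ^ (m - (l + 1))) * vT k n l) := by
  change psiLinear k n _ = _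
  rw [psiLinear_apply, vf_X]
  congr 1
  refine Finset.sum_congr rfl fun l _ => ?_
  rw [← smul_mul_assoc, ← polyT_smul, ← Polynomial.monomial_one_right_eq_X_pow (R := k),
    Polynomial.hasseDeriv_monomial, ← Polynomial.monomial_one_right_eq_X_pow (R := k),
    Polynomial.smul_monomial, smul_eq_mul]

theorem choose_smul_polyT_mul (n : ℕ) {p q r a : ℕ} (h : p + q = r) :
    (p.choose a : k) • (polyT n ((Polynomial.X : k[X]) ^ (p - a)) *
        polyT n ((Polynomial.X : k[X]) ^ q))
      = (p.choose a : k) • polyT n ((Polynomial.X : k[X]) ^ (r - a)) := by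
  rcases le_or_gt a p with ha | ha
  · rw [← polyT_mul, ← pow_add, show p - a + q = r - a by omega]
  · rw [Nat.choose_eq_zero_of_lt ha, Nat.cast_zero, zero_smul, zero_smul]

theorem dT_mul_polyT_X_pow (n m : ℕ) :
    dT k n * polyT n (Polynomial.X ^ m) = polyT n (Polynomial.X ^ m) * dT k n
      + (m : k) • polyT n (Polynomial.X ^ (m - 1)) := by
  rw [dT_mul_polyT, ← polyT_smul, Polynomial.derivative_X_pow, Polynomial.smul_eq_C_mul]

/-- The product `Ψ_n(e_{p-1}) Ψ_n(e_{q-1})`, as a combination of elements that depend only on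
`p + q`, with coefficients products of binomial coefficients in `p` and `q`. -/
theorem psi_mul_psi [CharZero k] (n : ℕ) {p q N : ℕ} (h : p + q = N) :
    psi k n (vf (Polynomial.X ^ p)) * psi k n (vf (Polynomial.X ^ q))
      = polyT n (Polynomial.X ^ N) * (dT k n * dT k n)
        + (q : k) • (polyT n (Polynomial.X ^ (N - 1)) * dT k n)
        + (∑ l ∈ Finset.range n, (q.choose (l + 1) : k) •
            (polyT n (Polynomial.X ^ (N - (l + 1))) * (dT k n * vT k n l))
          + ∑ l ∈ Finset.range n, (q.choose (l + 2) : k) •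
            (((l : k) + 2) • (polyT n (Polynomial.X ^ (N - (l + 2))) * vT k n l)))
        + ∑ l ∈ Finset.range n, (p.choose (l + 1) : k) •
            (polyT n (Polynomial.X ^ (N - (l + 1))) * (dT k n * vT k n l))
        + ∑ j ∈ Finset.range n, ∑ l ∈ Finset.range n, ((p.choose (j + 1) : k) * q.choose (l + 1)) •
            (polyT n (Polynomial.X ^ (N - (j + 1) - (l + 1))) * (vT k n j * vT k n l)) := by
  rw [psi_vf_X_pow, psi_vf_X_pow, add_mul, mul_add, mul_add, ← add_assoc]
  congr 1
  · congr 1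
    · congr 1
      · rw [mul_assoc, ← mul_assoc (dT k n), dT_mul_polyT_X_pow, add_mul, mul_add, mul_assoc,
          ← mul_assoc, ← polyT_mul, ← pow_add, h, smul_mul_assoc, mul_smul_comm]
        congr 1
        rcases Nat.eq_zero_or_pos q with rfl | hq
        · simp
        · rw [← mul_assoc, ← polyT_mul, ← pow_add, show p + (q - 1) = N - 1 by omega]
      · rw [Finset.mul_sum, ← Finset.sum_add_distrib]
        refine Finset.sum_congr rfl fun l _ => ?_
        have hc : (q.choose (l + 1) : k) * ((q - (l + 1) : ℕ) : k)
            = ((l : k) + 2) * q.choose (l + 2) := by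
          have := congrArg (Nat.cast (R := k)) (Nat.choose_succ_right_eq q (l + 1))
          push_cast at this
          linear_combination -this
        have hq (a : ℕ) := choose_smul_polyT_mul (k := k) n (a := a) ((add_comm q p).trans h)
        calc _ = (q.choose (l + 1) : k) • (polyT n (Polynomial.X ^ p) *
                (dT k n * polyT n (Polynomial.X ^ (q - (l + 1)))) * vT k n l) := by
              simp only [mul_smul_comm, mul_assoc]
          _ = (q.choose (l + 1) : k) • (polyT n (Polynomial.X ^ (q - (l + 1))) *
                polyT n (Polynomial.X ^ p)) * (dT k n * vT k n l)
              + ((q.choose (l + 1) : k) * ((q - (l + 1) : ℕ) : k)) •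
                (polyT n (Polynomial.X ^ (q - (l + 2))) * polyT n (Polynomial.X ^ p)) *
                vT k n l := by
              rw [dT_mul_polyT_X_pow, polyT_comm n (Polynomial.X ^ (q - (l + 1))),
                polyT_comm n (Polynomial.X ^ (q - (l + 2))), Nat.sub_sub]
              simp only [mul_add, add_mul, smul_add, mul_smul_comm, smul_mul_assoc, mul_assoc,
                mul_smul]
          _ = _ := by
              rw [hc, mul_smul, hq, hq]
              simp only [smul_mul_assoc]
              rw [smul_comm ((l : k) + 2)]
    · rw [Finset.sum_mul]
      refine Finset.sum_congr rfl fun l _ => ?_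
      rw [smul_mul_assoc, mul_assoc, ← mul_assoc (vT k n l), vT_mul_polyT, mul_assoc, vT_mul_dT,
        ← mul_assoc, ← smul_mul_assoc, choose_smul_polyT_mul n h, smul_mul_assoc]
  · rw [Finset.sum_mul_sum]
    refine Finset.sum_congr rfl fun j _ => Finset.sum_congr rfl fun l _ => ?_
    rw [smul_mul_smul_comm, mul_assoc, ← mul_assoc (vT k n j), vT_mul_polyT, mul_assoc,
      ← mul_assoc]
    rcases le_or_gt (j + 1) p with hp | hp
    · have hq := choose_smul_polyT_mul (k := k) n (a := l + 1)
        (show q + (p - (j + 1)) = N - (j + 1) by omega)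
      rw [polyT_comm, ← smul_mul_assoc, mul_smul, hq, ← mul_smul, smul_mul_assoc]
    · simp [Nat.choose_eq_zero_of_lt hp]

/-- In the expansion `psi_mul_psi`, only the coefficient of `v_{n-1} v_{n-1}` has the degree `2 n`
that survives the `2n`-th finite difference. -/
theorem Psi_differentiator [CharZero k] {n : ℕ} (hn : 2 ≤ n) :
    Psi k n (differentiator k (2 * n) (2 * n - 1) (-1))
      = ((-1) ^ n * ((2 * n).choose n : k)) • vT k n (n - 1) ^ 2 := by
  have hterm : ∀ i ∈ Finset.range (2 * n + 1),
      Psi k n (((-1 : k) ^ i * ((2 * n).choose i : k)) •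
        (UniversalEnvelopingAlgebra.ι k (e k ((2 * n - 1 : ℤ) - i)) *
          UniversalEnvelopingAlgebra.ι k (e k (-1 + i))))
      = ((-1 : k) ^ i * ((2 * n).choose i : k)) • (psi k n (vf (Polynomial.X ^ (2 * n - i))) *
          psi k n (vf (Polynomial.X ^ i))) := fun i hi => by
    have := Finset.mem_range.1 hi
    rw [map_smul, map_mul, Psi, UniversalEnvelopingAlgebra.lift_ι_apply,
      UniversalEnvelopingAlgebra.lift_ι_apply, e, e,
      show ((2 * n - 1 : ℤ) - i + 1).toNat = 2 * n - i by omega,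
      show (-1 + (i : ℤ) + 1).toNat = i by omega]
  have hzero {a b : ℕ} (h : a + b < 2 * n) (x : T k n) : ∑ i ∈ Finset.range (2 * n + 1),
      ((-1 : k) ^ i * ((2 * n).choose i : k)) •
        ((((2 * n - i).choose a : k) * (i.choose b : k)) • x) = 0 := by
    have h1 := sum_alternating_choose_mul_choose_mul_choose k a b (2 * n - a - b)
    rw [show a + b + (2 * n - a - b) = 2 * n by omega, if_neg (by omega)] at h1
    simp only [smul_smul, ← Finset.sum_smul, h1, zero_smul]
  have htop := sum_alternating_choose_mul_choose_mul_choose k n n 0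
  rw [if_pos rfl, add_zero, ← two_mul] at htop
  have hleft {a : ℕ} (h : a < 2 * n) (x : T k n) : ∑ i ∈ Finset.range (2 * n + 1),
      ((-1 : k) ^ i * ((2 * n).choose i : k)) • (((2 * n - i).choose a : k) • x) = 0 := by
    simpa using hzero (a := a) (b := 0) h x
  have hright {b : ℕ} (h : b < 2 * n) (x : T k n) : ∑ i ∈ Finset.range (2 * n + 1),
      ((-1 : k) ^ i * ((2 * n).choose i : k)) • ((i.choose b : k) • x) = 0 := by
    simpa using hzero (a := 0) (b := b) (by omega) x
  rw [differentiator, map_sum, Finset.sum_congr rfl hterm]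
  have hmul : ∀ i ∈ Finset.range (2 * n + 1), ((-1 : k) ^ i * ((2 * n).choose i : k)) •
      (psi k n (vf (Polynomial.X ^ (2 * n - i))) * psi k n (vf (Polynomial.X ^ i))) =
      ((-1 : k) ^ i * ((2 * n).choose i : k)) • (_ + _ + (_ + _) + _ + _) :=
    fun i hi => congrArg _ <|
      psi_mul_psi n (Nat.sub_add_cancel (Nat.lt_succ_iff.1 (Finset.mem_range.1 hi)))
  rw [Finset.sum_congr rfl hmul]
  simp only [smul_add, Finset.sum_add_distrib, Finset.smul_sum]
  have h00 := hleft (a := 0) (by omega) (polyT n (Polynomial.X ^ (2 * n)) * (dT k n * dT k n))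
  have h01 := hright (b := 1) (by omega) (polyT n (Polynomial.X ^ (2 * n - 1)) * dT k n)
  simp only [Nat.choose_zero_right, Nat.cast_one, one_smul, Nat.choose_one_right] at h00 h01
  have hdrop {a b c d e f : T k n} (ha : a = 0) (hb : b = 0) (hc : c = 0) (hd : d = 0)
      (he : e = 0) : a + b + (c + d) + e + f = f := by
    rw [ha, hb, hc, hd, he, zero_add, zero_add, zero_add, zero_add]
  refine (hdrop h00 h01 ?_ ?_ ?_).trans ?_
  · rw [Finset.sum_comm]
    refine Finset.sum_eq_zero fun l hl => hright ?_ _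
    have := Finset.mem_range.1 hl
    omega
  · rw [Finset.sum_comm]
    refine Finset.sum_eq_zero fun l hl => hright ?_ _
    have := Finset.mem_range.1 hl
    omega
  · rw [Finset.sum_comm]
    refine Finset.sum_eq_zero fun l hl => hleft ?_ _
    have := Finset.mem_range.1 hl
    omega
  rw [Finset.sum_comm, Finset.sum_eq_single (n - 1), Finset.sum_comm,
    Finset.sum_eq_single (n - 1)]
  · simp only [← mul_smul]
    rw [← Finset.sum_smul, show n - 1 + 1 = n by omega, htop, show 2 * n - n - n = 0 by omega]
    simp [polyT, weylPoly, sq, ← Algebra.TensorProduct.one_def]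
  · intro l hl hl'
    have := Finset.mem_range.1 hl
    exact hzero (by omega) _
  · intro h
    exact absurd (Finset.mem_range.2 (by omega)) h
  · intro j hj hj'
    have := Finset.mem_range.1 hj
    rw [Finset.sum_comm]
    refine Finset.sum_eq_zero fun l hl => ?_
    have := Finset.mem_range.1 hl
    exact hzero (by omega) _
  · intro h
    exact absurd (Finset.mem_range.2 (by omega)) h

/-! ### Generators of `T_n` and normality of `v_{n-1}^2` -/

theorem adjoin_weyl : Algebra.adjoin k {weylT k, weylD k} = ⊤ := by
  have h := congrArg (Subalgebra.map (weylMk k)) (FreeAlgebra.adjoin_range_ι k (Fin 2))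
  rw [AlgHom.map_adjoin, ← Set.range_comp, Algebra.map_top,
    show (weylMk k).range = ⊤ from
      (AlgHom.range_eq_top _).2 (RingQuot.mkAlgHom_surjective k (WeylRel k))] at h
  rw [← h]
  congr 1
  ext x
  simp [Fin.exists_fin_two, weylT, weylD, eq_comm]

theorem adjoin_range_universalEnveloping_ι (R L : Type*) [CommRing R] [LieRing L]
    [LieAlgebra R L] :
    Algebra.adjoin R (Set.range (UniversalEnvelopingAlgebra.ι R : L →ₗ⁅R⁆ _)) = ⊤ := by
  set S := Algebra.adjoin R (Set.range (UniversalEnvelopingAlgebra.ι R : L →ₗ⁅R⁆ _))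
  have hmem (x : L) : UniversalEnvelopingAlgebra.ι R x ∈ S :=
    Algebra.subset_adjoin (Set.mem_range_self x)
  let f : L →ₗ⁅R⁆ S :=
    { toFun := fun x => ⟨UniversalEnvelopingAlgebra.ι R x, hmem x⟩
      map_add' := fun x y => Subtype.ext (map_add _ x y)
      map_smul' := fun c x => Subtype.ext (map_smul _ c x)
      map_lie' := fun {x y} => Subtype.ext (LieHom.map_lie _ x y) }
  have h : S.val.comp (UniversalEnvelopingAlgebra.lift R f) = AlgHom.id R _ := by
    ext x
    simp [f]
  refine eq_top_iff.2 fun x _ => ?_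
  have hx := congrArg (fun F => F x) h
  simp only [AlgHom.comp_apply, AlgHom.id_apply] at hx
  rw [← hx]
  exact (UniversalEnvelopingAlgebra.lift R f x).2

theorem span_range_v (n : ℕ) : Submodule.span k (Set.range (v k n)) = ⊤ := by
  refine top_le_iff.1 fun x _ => ?_
  obtain ⟨⟨D, hD⟩, rfl⟩ := LieSubmodule.Quotient.surjective_mk' _ x
  induction hD using Submodule.span_induction with
  | mem D hD =>
    obtain ⟨i, hi, -, rfl⟩ := hD
    lift i to ℕ using hi
    exact Submodule.subset_span ⟨i, rfl⟩
  | zero => exact Submodule.zero_mem _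
  | add D E hD hE h1 h2 => exact Submodule.add_mem _ (h1 trivial) (h2 trivial)
  | smul c D hD h => exact Submodule.smul_mem _ c (h trivial)

/-- `T_n` is generated as an algebra by `t`, `∂` and the `v_i`. -/
theorem subalgebra_T_eq_top {n : ℕ} (S : Subalgebra k (T k n))
    (ht : polyT n Polynomial.X ∈ S) (hd : dT k n ∈ S) (hv : ∀ i, vT k n i ∈ S) : S = ⊤ := by
  have hA : S.comap Algebra.TensorProduct.includeLeft = (⊤ : Subalgebra k (Weyl k)) := by
    rw [← top_le_iff, ← adjoin_weyl, Algebra.adjoin_le_iff]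
    rintro x (rfl | rfl)
    · simpa [polyT, weylPoly] using ht
    · simpa [dT] using hd
  have hU : S.comap Algebra.TensorProduct.includeRight
      = (⊤ : Subalgebra k (UniversalEnvelopingAlgebra k (g k n))) := by
    rw [← top_le_iff, ← adjoin_range_universalEnveloping_ι, Algebra.adjoin_le_iff]
    rintro _ ⟨x, rfl⟩
    have hx : x ∈ Submodule.span k (Set.range (v k n)) := span_range_v (k := k) n ▸ trivial
    induction hx using Submodule.span_induction with
    | mem x hx =>
      obtain ⟨i, rfl⟩ := hx
      exact hv i
    | zero => rw [map_zero]; exact zero_mem _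
    | add x y _ _ hx hy => rw [map_add]; exact add_mem hx hy
    | smul c x _ hx => rw [map_smul]; exact Subalgebra.smul_mem _ hx c
  refine top_le_iff.1 fun x _ => ?_
  induction x using TensorProduct.induction_on with
  | zero => exact S.zero_mem
  | add x y hx hy => exact S.add_mem (hx trivial) (hy trivial)
  | tmul a u =>
    have ha : a ∈ S.comap Algebra.TensorProduct.includeLeft := hA ▸ Algebra.mem_top
    have hu : u ∈ S.comap Algebra.TensorProduct.includeRight := hU ▸ Algebra.mem_top
    simpa using S.mul_mem ha hu

theorem vT_zero_mul_sq (n : ℕ) :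
    vT k n 0 * vT k n (n - 1) ^ 2
      = vT k n (n - 1) ^ 2 * vT k n 0 + (2 * ((n - 1 : ℕ) : k)) • vT k n (n - 1) ^ 2 := by
  have h := vT_comm (k := k) n 0 (n - 1)
  rw [Nat.cast_zero, sub_zero, zero_add] at h
  rw [sq, ← mul_assoc, h, add_mul, mul_assoc, h, mul_add, smul_mul_assoc, mul_smul_comm,
    ← mul_assoc, add_assoc, ← add_smul, two_mul]

theorem vT_mul_sq {n i : ℕ} (hi : 1 ≤ i) :
    vT k n i * vT k n (n - 1) ^ 2 = vT k n (n - 1) ^ 2 * vT k n i := by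
  have h := vT_comm (k := k) n i (n - 1)
  rw [vT_eq_zero (by omega : n ≤ i + (n - 1)), smul_zero, add_zero] at h
  exact (Commute.pow_right h 2).eq

theorem dT_mul_sq (n : ℕ) :
    dT k n * vT k n (n - 1) ^ 2 = vT k n (n - 1) ^ 2 * dT k n :=
  (Commute.pow_right (vT_mul_dT n (n - 1)).symm 2).eq

theorem polyT_mul_sq (n : ℕ) (f : k[X]) :
    polyT n f * vT k n (n - 1) ^ 2 = vT k n (n - 1) ^ 2 * polyT n f :=
  (Commute.pow_right (vT_mul_polyT n (n - 1) f).symm 2).eq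

/-- `v_{n-1}^2` is a normal element of `T_n`: moving it past `v_0` only shifts `v_0` by a
scalar. -/
theorem exists_sq_mul_eq {n : ℕ} (x : T k n) :
    ∃ y, vT k n (n - 1) ^ 2 * x = y * vT k n (n - 1) ^ 2 := by
  let S : Subalgebra k (T k n) :=
    { carrier := {x | ∃ y, vT k n (n - 1) ^ 2 * x = y * vT k n (n - 1) ^ 2}
      mul_mem' := by
        rintro x x' ⟨y, hy⟩ ⟨y', hy'⟩
        exact ⟨y * y', by rw [← mul_assoc, hy, mul_assoc, hy', mul_assoc]⟩
      add_mem' := by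
        rintro x x' ⟨y, hy⟩ ⟨y', hy'⟩
        exact ⟨y + y', by rw [mul_add, hy, hy', add_mul]⟩
      algebraMap_mem' := fun c => ⟨algebraMap k _ c, (Algebra.commutes c _).symm⟩ }
  have hS : S = ⊤ := by
    refine subalgebra_T_eq_top S ⟨_, (polyT_mul_sq n _).symm⟩ ⟨_, (dT_mul_sq n).symm⟩ fun i => ?_
    rcases Nat.eq_zero_or_pos i with rfl | hi
    · refine ⟨vT k n 0 - algebraMap k _ (2 * ((n - 1 : ℕ) : k)), ?_⟩
      rw [sub_mul, vT_zero_mul_sq n, ← Algebra.smul_def, add_sub_cancel_right]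
    · exact ⟨_, (vT_mul_sq hi).symm⟩
  exact hS.ge (Algebra.mem_top (x := x))

theorem exists_mul_sq_eq {n : ℕ} (x : T k n) :
    ∃ y, x * vT k n (n - 1) ^ 2 = vT k n (n - 1) ^ 2 * y := by
  let S : Subalgebra k (T k n) :=
    { carrier := {x | ∃ y, x * vT k n (n - 1) ^ 2 = vT k n (n - 1) ^ 2 * y}
      mul_mem' := by
        rintro x x' ⟨y, hy⟩ ⟨y', hy'⟩
        exact ⟨y * y', by rw [mul_assoc, hy', ← mul_assoc, hy, mul_assoc]⟩
      add_mem' := by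
        rintro x x' ⟨y, hy⟩ ⟨y', hy'⟩
        exact ⟨y + y', by rw [add_mul, hy, hy', mul_add]⟩
      algebraMap_mem' := fun c => ⟨algebraMap k _ c, Algebra.commutes c _⟩ }
  have hS : S = ⊤ := by
    refine subalgebra_T_eq_top S ⟨_, polyT_mul_sq n _⟩ ⟨_, dT_mul_sq n⟩ fun i => ?_
    rcases Nat.eq_zero_or_pos i with rfl | hi
    · refine ⟨vT k n 0 + algebraMap k _ (2 * ((n - 1 : ℕ) : k)), ?_⟩
      rw [mul_add, vT_zero_mul_sq n, ← Algebra.commutes, ← Algebra.smul_def]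
    · exact ⟨_, vT_mul_sq hi⟩
  exact hS.ge (Algebra.mem_top (x := x))

theorem span_sq_eq_twoSidedIdeal_span (n : ℕ) :
    ((Ideal.span {vT k n (n - 1) ^ 2} : Ideal (T k n)) : Set (T k n))
      = TwoSidedIdeal.span {vT k n (n - 1) ^ 2} := by
  have h2 : (Ideal.span {vT k n (n - 1) ^ 2} : Ideal (T k n)).IsTwoSided := ⟨by
    intro a b ha
    obtain ⟨x, rfl⟩ := Ideal.mem_span_singleton'.1 ha
    obtain ⟨y, hy⟩ := exists_sq_mul_eq b
    rw [mul_assoc, hy, ← mul_assoc]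
    exact Ideal.mem_span_singleton'.2 ⟨_, rfl⟩⟩
  refine Set.Subset.antisymm ?_ ?_
  · intro x hx
    obtain ⟨a, rfl⟩ := Ideal.mem_span_singleton'.1 hx
    exact TwoSidedIdeal.mul_mem_left _ _ _ (TwoSidedIdeal.subset_span rfl)
  · rw [← Ideal.coe_toTwoSided, ← TwoSidedIdeal.le_iff, TwoSidedIdeal.span_le,
      Ideal.coe_toTwoSided]
    exact Ideal.subset_span

/-! ### The two-sided ideal of `B_n` generated by `v_{n-1}^2` -/

theorem psi_mul_sq [CharZero k] {n : ℕ} (hn : 1 ≤ n) (m : ℕ) :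
    psi k n (vf (Polynomial.X ^ m)) * vT k n (n - 1) ^ 2
      = vT k n (n - 1) ^ 2 * psi k n (vf (Polynomial.X ^ m))
        + ((m : k) * (2 * ((n - 1 : ℕ) : k))) •
          (polyT n (Polynomial.X ^ (m - 1)) * vT k n (n - 1) ^ 2) := by
  obtain ⟨N, rfl⟩ : ∃ N, n = N + 1 := ⟨n - 1, by omega⟩
  have h0 := vT_zero_mul_sq (k := k) (N + 1)
  have h1 (i : ℕ) := vT_mul_sq (k := k) (n := N + 1) (i := i + 1) (by omega)
  have hp (f : k[X]) := polyT_mul_sq (N + 1) f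
  have hd := dT_mul_sq (k := k) (N + 1)
  simp only [Nat.add_sub_cancel] at h0 h1 hp hd ⊢
  rw [psi_vf_X_pow, add_mul, mul_add, add_assoc]
  congr 1
  · rw [mul_assoc, hd, ← mul_assoc, hp, mul_assoc]
  · rw [Finset.sum_range_succ', add_mul, mul_add, add_assoc]
    congr 1
    · rw [Finset.sum_mul, Finset.mul_sum]
      refine Finset.sum_congr rfl fun l _ => ?_
      rw [smul_mul_assoc, mul_smul_comm, mul_assoc, h1, ← mul_assoc, hp, mul_assoc]
    · rw [zero_add, Nat.choose_one_right, smul_mul_assoc, mul_smul_comm, mul_assoc, h0, mul_add,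
        mul_smul_comm, ← mul_assoc, hp, mul_assoc, smul_add, smul_smul]

/-- A `B_n`-subbimodule `M` of `T_n` that contains `v_{n-1}^2` contains `T_n v_{n-1}^2`. -/
theorem mul_sq_mem [CharZero k] {n : ℕ} (hn : 2 ≤ n) (M : Submodule k (T k n))
    (hl : ∀ D, ∀ x ∈ M, psi k n D * x ∈ M) (hr : ∀ D, ∀ x ∈ M, x * psi k n D ∈ M)
    (h : vT k n (n - 1) ^ 2 ∈ M) (a : T k n) : a * vT k n (n - 1) ^ 2 ∈ M := by
  -- The commutator of `Ψ_n(e_m)` with `v_{n-1}^2` is `2 (n-1) (m+1) t^m v_{n-1}^2`.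
  have hpoly (m : ℕ) : polyT n (Polynomial.X ^ m) * vT k n (n - 1) ^ 2 ∈ M := by
    have h1 := M.sub_mem (hl (vf (Polynomial.X ^ (m + 1))) _ h)
      (hr (vf (Polynomial.X ^ (m + 1))) _ h)
    rw [psi_mul_sq (by omega), add_sub_cancel_left, Nat.add_sub_cancel] at h1
    refine (Submodule.smul_mem_iff M ?_).1 h1
    have h2 : ((n - 1 : ℕ) : k) ≠ 0 := Nat.cast_ne_zero.2 (by omega)
    exact mul_ne_zero (Nat.cast_ne_zero.2 (by omega)) (mul_ne_zero two_ne_zero h2)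
  -- The `y` whose left multiplication preserves the set of `x` with `t^j x v_{n-1}^2 ∈ M`
  -- for all `j`.
  let S : Subalgebra k (T k n) :=
    { carrier := {y | ∀ x, (∀ j, polyT n (Polynomial.X ^ j) * (x * vT k n (n - 1) ^ 2) ∈ M) →
        ∀ j, polyT n (Polynomial.X ^ j) * (y * x * vT k n (n - 1) ^ 2) ∈ M}
      mul_mem' := by
        intro y y' hy hy' x hx
        rw [mul_assoc y y' x]
        exact hy _ (hy' x hx)
      add_mem' := by
        intro y y' hy hy' x hx j
        rw [add_mul, add_mul, mul_add]
        exact M.add_mem (hy x hx j) (hy' x hx j)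
      algebraMap_mem' := by
        intro c x hx j
        rw [← Algebra.smul_def, smul_mul_assoc, mul_smul_comm]
        exact M.smul_mem _ (hx j) }
  have hd : dT k n ∈ S := by
    intro x hx j
    -- `∂ = Ψ_n(e_{-1})`.
    have h1 := hl (vf (Polynomial.X ^ 0)) _ (hx j)
    rw [psi_vf_X_pow, Finset.sum_eq_zero (by simp), add_zero, pow_zero, polyT] at h1
    rw [show weylPoly (1 : k[X]) ⊗ₜ[k] (1 : UniversalEnvelopingAlgebra k (g k n)) = 1 by
      simp [weylPoly, Algebra.TensorProduct.one_def], one_mul, ← mul_assoc, dT_mul_polyT_X_pow,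
      add_mul, smul_mul_assoc] at h1
    have h2 := M.sub_mem h1 (M.smul_mem (j : k) (hx (j - 1)))
    rwa [add_sub_cancel_right, mul_assoc, ← mul_assoc (dT k n)] at h2
  have ht : polyT n Polynomial.X ∈ S := by
    intro x hx j
    rw [mul_assoc, ← mul_assoc (polyT n _), ← polyT_mul, ← pow_succ]
    exact hx _
  have hv : ∀ i, vT k n i ∈ S := by
    intro i
    induction i using Nat.strong_induction_on with
    | _ i ih =>
    rcases le_or_gt n i with hi | hi
    · rw [vT_eq_zero hi]
      exact S.zero_mem
    intro x hx j
    -- In `Ψ_n(e_i) t^j x v_{n-1}^2` the terms with `∂` and with `v_l`, `l < i`, are known to lie in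
    -- `M`; what remains is `t^j v_i x v_{n-1}^2`.
    have h1 := hl (vf (Polynomial.X ^ (i + 1))) _ (hx j)
    rw [psi_vf_X_pow, add_mul, Finset.sum_mul] at h1
    have hdx : polyT n (Polynomial.X ^ (i + 1)) * dT k n *
        (polyT n (Polynomial.X ^ j) * (x * vT k n (n - 1) ^ 2)) ∈ M := by
      rw [mul_assoc, ← mul_assoc (dT k n), dT_mul_polyT_X_pow, add_mul, mul_add, smul_mul_assoc,
        mul_smul_comm, mul_assoc (polyT n (Polynomial.X ^ j)), ← mul_assoc (polyT n _),
        ← mul_assoc (polyT n _) (polyT n _), ← polyT_mul, ← polyT_mul, ← pow_add, ← pow_add,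
        ← mul_assoc (dT k n)]
      exact M.add_mem (hd x hx _) (M.smul_mem _ (hx _))
    have hterm (l : ℕ) : ((i + 1).choose (l + 1) : k) •
        (polyT n (Polynomial.X ^ (i + 1 - (l + 1))) * vT k n l) *
          (polyT n (Polynomial.X ^ j) * (x * vT k n (n - 1) ^ 2))
        = ((i + 1).choose (l + 1) : k) •
          (polyT n (Polynomial.X ^ (i - l + j)) * (vT k n l * x * vT k n (n - 1) ^ 2)) := by
      rw [smul_mul_assoc, mul_assoc, ← mul_assoc (vT k n l), vT_mul_polyT, mul_assoc,
        ← mul_assoc (polyT n _), ← polyT_mul, ← pow_add, Nat.add_sub_add_right,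
        ← mul_assoc (vT k n l)]
    rw [← Finset.add_sum_erase _ _ (Finset.mem_range.2 hi), add_left_comm, hterm] at h1
    rw [Submodule.add_mem_iff_left] at h1
    · simpa using h1
    · refine M.add_mem hdx (M.sum_mem fun l hl' => ?_)
      rw [hterm]
      rcases lt_or_ge l i with hli | hli
      · exact M.smul_mem _ (ih l hli x hx _)
      · have hne := Finset.ne_of_mem_erase hl'
        rw [Nat.choose_eq_zero_of_lt (by omega), Nat.cast_zero, zero_smul]
        exact M.zero_mem
  have hS := subalgebra_T_eq_top S ht hd hv
  have ha : a ∈ S := hS ▸ Algebra.mem_top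
  have hpoly1 (m : ℕ) : polyT n (Polynomial.X ^ m) * (1 * vT k n (n - 1) ^ 2) ∈ M := by
    rw [one_mul]
    exact hpoly m
  simpa [polyT, weylPoly, ← Algebra.TensorProduct.one_def] using ha 1 hpoly1 0

/-! ### A representation of `𝔤_n` on which `v_{n-1}^2` has rank one -/

theorem linearMap_g_ext {n : ℕ} {M : Type*} [AddCommGroup M] [Module k M]
    {f f' : g k n →ₗ[k] M} (h : ∀ i, f (v k n i) = f' (v k n i)) : f = f' :=
  LinearMap.ext_on_range (span_range_v n) h

variable (k) in
/-- The linear functional on `𝔤_n` (`n ≥ 1`) that sends `v_0` to `1` and the other `v_i` to `0`. -/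
def coeffZero {n : ℕ} (hn : 1 ≤ n) : g k n →ₗ[k] k :=
  (wittIdeal k n).toSubmodule.liftQ
    { toFun := fun D => ((D : Witt k) Polynomial.X).coeff 1
      map_add' := fun D E => by simp
      map_smul' := fun c D => by simp } <| by
    intro D hD
    have hD' : (Polynomial.X : k[X]) ^ ((n : ℤ) + 1).toNat ∣ (D : Witt k) Polynomial.X :=
      (mem_wittGE _ _).1 hD
    exact Polynomial.X_pow_dvd_iff.1 hD' 1 (by omega)

theorem coeffZero_v {n : ℕ} (hn : 1 ≤ n) (i : ℕ) :
    coeffZero k hn (v k n i) = if i = 0 then 1 else 0 := by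
  have h : coeffZero k hn (v k n i) = ((e k i : Witt k) Polynomial.X).coeff 1 := rfl
  rw [h, e, vf_X, Polynomial.coeff_X_pow]
  congr 1
  rw [eq_iff_iff]
  omega

theorem coeffZero_lie {n : ℕ} (hn : 1 ≤ n) (x y : g k n) : coeffZero k hn ⁅x, y⁆ = 0 := by
  have h : (LieModule.toEnd k (g k n) (g k n)).toLinearMap.compr₂ (coeffZero k hn) = 0 := by
    refine linearMap_g_ext fun i => linearMap_g_ext fun j => ?_
    change coeffZero k hn ⁅v k n i, v k n j⁆ = 0
    rw [lie_v, map_smul, coeffZero_v]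
    -- The bracket has a `v_0` component only for `i = j = 0`, where it vanishes.
    split_ifs with hij
    · obtain ⟨rfl, rfl⟩ : i = 0 ∧ j = 0 := by omega
      simp
    · simp
  exact LinearMap.congr_fun (LinearMap.congr_fun h x) y

theorem lie_v_top {n : ℕ} (hn : 1 ≤ n) (x : g k n) :
    ⁅x, v k n (n - 1)⁆ = (((n - 1 : ℕ) : k) * coeffZero k hn x) • v k n (n - 1) := by
  have h : (LieModule.toEnd k (g k n) (g k n)).toLinearMap.flip (v k n (n - 1))
      = (((n - 1 : ℕ) : k) • coeffZero k hn).smulRight (v k n (n - 1)) := by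
    refine linearMap_g_ext fun i => ?_
    change ⁅v k n i, v k n (n - 1)⁆
      = (((n - 1 : ℕ) : k) * coeffZero k hn (v k n i)) • v k n (n - 1)
    rw [lie_v, coeffZero_v]
    split_ifs with hi
    · subst hi
      simp
    · rw [v_eq_zero (by omega : n ≤ i + (n - 1))]
      simp
  exact LinearMap.congr_fun h x

theorem v_top_ne_zero {n : ℕ} (hn : 1 ≤ n) : v k n (n - 1) ≠ 0 := by
  intro h
  have h1 : (Polynomial.X : k[X]) ^ ((n : ℤ) + 1).toNat ∣ (e k ((n - 1 : ℕ) : ℤ)) Polynomial.X :=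
    (mem_wittGE _ _).1 (LieSubmodule.Quotient.mk_eq_zero'.1 h)
  rw [e, vf_X, Polynomial.X_pow_dvd_iff] at h1
  have h2 := h1 n (by omega)
  rw [show (((n - 1 : ℕ) : ℤ) + 1).toNat = n by omega, Polynomial.coeff_X_pow_self] at h2
  exact one_ne_zero h2

/-- The character `v_0 ↦ c`, `v_i ↦ 0` (`i ≥ 1`) of `U(𝔤_n)`. -/
def character {n : ℕ} (hn : 1 ≤ n) (c : k) : UniversalEnvelopingAlgebra k (g k n) →ₐ[k] k :=
  UniversalEnvelopingAlgebra.lift k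
    { toLinearMap := c • coeffZero k hn
      map_lie' := fun {x y} => by
        change c * coeffZero k hn ⁅x, y⁆ = _
        rw [coeffZero_lie, LieRing.of_associative_ring_bracket, mul_zero]
        exact (sub_eq_zero.2 (mul_comm (_ : k) _)).symm }

theorem character_ι {n : ℕ} (hn : 1 ≤ n) (c : k) (x : g k n) :
    character hn c (UniversalEnvelopingAlgebra.ι k x) = c * coeffZero k hn x := by
  rw [character, UniversalEnvelopingAlgebra.lift_ι_apply]
  rfl

/-- The action of `U(𝔤_n)` on `𝔤_n ⊗ 𝔤_n`, the tensor square of the adjoint representation, twisted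
by the character `v_0 ↦ c`. -/
def twistedAction {n : ℕ} (hn : 1 ≤ n) (c : k) :
    UniversalEnvelopingAlgebra k (g k n) →ₐ[k] Module.End k (g k n ⊗[k] g k n) :=
  UniversalEnvelopingAlgebra.lift k
    { toLinearMap := (LieModule.toEnd k (g k n) (g k n ⊗[k] g k n)).toLinearMap
        + (c • coeffZero k hn).smulRight 1
      map_lie' := fun {x y} => by
        change LieModule.toEnd k (g k n) (g k n ⊗[k] g k n) ⁅x, y⁆
            + (c * coeffZero k hn ⁅x, y⁆) • (1 : Module.End k (g k n ⊗[k] g k n))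
          = ⁅LieModule.toEnd k (g k n) (g k n ⊗[k] g k n) x + (c * coeffZero k hn x) • 1,
            LieModule.toEnd k (g k n) (g k n ⊗[k] g k n) y + (c * coeffZero k hn y) • 1⁆
        rw [coeffZero_lie, LieHom.map_lie, LieRing.of_associative_ring_bracket,
          LieRing.of_associative_ring_bracket]
        simp only [mul_add, add_mul, smul_mul_assoc, mul_smul_comm, one_mul, mul_one, mul_zero,
          zero_smul, add_zero, smul_add]
        rw [smul_comm (c * coeffZero k hn x) (c * coeffZero k hn y)]
        abel }

theorem twistedAction_ι {n : ℕ} (hn : 1 ≤ n) (c : k) (x : g k n) (y : g k n ⊗[k] g k n) :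
    twistedAction hn c (UniversalEnvelopingAlgebra.ι k x) y
      = ⁅x, y⁆ + (c * coeffZero k hn x) • y := by
  rw [twistedAction, UniversalEnvelopingAlgebra.lift_ι_apply]
  rfl

/-- The linear functional on `𝔤_n ⊗ 𝔤_n` reading off the coefficient of `v_0 ⊗ v_0`. -/
def coeffZeroSq {n : ℕ} (hn : 1 ≤ n) : g k n ⊗[k] g k n →ₗ[k] k :=
  LinearMap.mul' k k ∘ₗ TensorProduct.map (coeffZero k hn) (coeffZero k hn)

theorem coeffZeroSq_tmul {n : ℕ} (hn : 1 ≤ n) (x y : g k n) :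
    coeffZeroSq hn (x ⊗ₜ[k] y) = coeffZero k hn x * coeffZero k hn y := rfl

theorem coeffZeroSq_lie {n : ℕ} (hn : 1 ≤ n) (x : g k n) (y : g k n ⊗[k] g k n) :
    coeffZeroSq hn ⁅x, y⁆ = 0 := by
  induction y using TensorProduct.induction_on with
  | zero => simp
  | add y z hy hz => rw [lie_add, map_add, hy, hz, add_zero]
  | tmul y z =>
    rw [TensorProduct.LieModule.lie_tmul_right, map_add, coeffZeroSq_tmul, coeffZeroSq_tmul,
      coeffZero_lie, coeffZero_lie, zero_mul, mul_zero, add_zero]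

/-- `v_{n-1}^2` maps all of `𝔤_n ⊗ 𝔤_n` to the line spanned by `v_{n-1} ⊗ v_{n-1}`: `ad v_{n-1}`
kills every `v_i` with `i ≥ 1` and sends `v_0` to `-(n-1) v_{n-1}`. -/
theorem twistedAction_sq {n : ℕ} (hn : 2 ≤ n) (c : k) (y : g k n ⊗[k] g k n) :
    twistedAction (by omega) c (UniversalEnvelopingAlgebra.ι k (v k n (n - 1)) ^ 2) y
      = (2 * ((n - 1 : ℕ) : k) ^ 2 * coeffZeroSq (by omega) y) •
        (v k n (n - 1) ⊗ₜ[k] v k n (n - 1)) := by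
  have hn1 : 1 ≤ n := by omega
  have hv (x : g k n) : ⁅v k n (n - 1), x⁆
      = -((((n - 1 : ℕ) : k) * coeffZero k hn1 x) • v k n (n - 1)) := by
    rw [← lie_skew, lie_v_top hn1]
  have h0 : coeffZero k hn1 (v k n (n - 1)) = 0 := by
    rw [coeffZero_v, if_neg (by omega)]
  rw [sq, map_mul, Module.End.mul_apply, twistedAction_ι, twistedAction_ι, h0, mul_zero, zero_smul,
    add_zero, zero_smul, add_zero]
  induction y using TensorProduct.induction_on with
  | zero => simp
  | add y z hy hz => rw [lie_add, lie_add, map_add, hy, hz, mul_add, add_smul]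
  | tmul y z =>
    simp only [TensorProduct.LieModule.lie_tmul_right, lie_add, hv, coeffZeroSq_tmul,
      TensorProduct.neg_tmul, TensorProduct.tmul_neg, ← TensorProduct.smul_tmul',
      TensorProduct.tmul_smul, lie_neg, lie_smul, h0]
    module

theorem twistedAction_top {n : ℕ} (hn : 1 ≤ n) (c : k)
    (a : UniversalEnvelopingAlgebra k (g k n)) :
    twistedAction hn c a (v k n (n - 1) ⊗ₜ[k] v k n (n - 1))
      = character hn (c + 2 * ((n - 1 : ℕ) : k)) a • (v k n (n - 1) ⊗ₜ[k] v k n (n - 1)) := by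
  have ha : a ∈ Algebra.adjoin k (Set.range (UniversalEnvelopingAlgebra.ι k : g k n →ₗ⁅k⁆ _)) :=
    adjoin_range_universalEnveloping_ι k (g k n) ▸ Algebra.mem_top
  induction ha using Algebra.adjoin_induction with
  | mem a ha =>
    obtain ⟨x, rfl⟩ := ha
    rw [twistedAction_ι, character_ι, TensorProduct.LieModule.lie_tmul_right, lie_v_top hn,
      ← TensorProduct.smul_tmul', TensorProduct.tmul_smul]
    module
  | algebraMap c => simp [Module.algebraMap_end_apply]
  | add a b _ _ ha hb => rw [map_add, map_add, LinearMap.add_apply, ha, hb, add_smul]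
  | mul a b _ _ ha hb =>
    rw [map_mul, map_mul, Module.End.mul_apply, hb, map_smul, ha, smul_smul, mul_comm]

theorem coeffZeroSq_twistedAction {n : ℕ} (hn : 1 ≤ n) (c : k)
    (a : UniversalEnvelopingAlgebra k (g k n)) (y : g k n ⊗[k] g k n) :
    coeffZeroSq hn (twistedAction hn c a y) = character hn c a * coeffZeroSq hn y := by
  have ha : a ∈ Algebra.adjoin k (Set.range (UniversalEnvelopingAlgebra.ι k : g k n →ₗ⁅k⁆ _)) :=
    adjoin_range_universalEnveloping_ι k (g k n) ▸ Algebra.mem_top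
  induction ha using Algebra.adjoin_induction generalizing y with
  | mem a ha =>
    obtain ⟨x, rfl⟩ := ha
    rw [twistedAction_ι, character_ι, map_add, coeffZeroSq_lie, zero_add, map_smul, smul_eq_mul]
  | algebraMap c => simp [Module.algebraMap_end_apply]
  | add a b _ _ ha hb => rw [map_add, map_add, LinearMap.add_apply, map_add, ha, hb, add_mul]
  | mul a b _ _ ha hb =>
    rw [map_mul, map_mul, Module.End.mul_apply, ha, hb, mul_assoc]

/-- A functional `φ` with `φ (a v_{n-1}^2) = χ (a)` and `φ (v_{n-1}^2 a) = χ' (a)` for characters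
`χ` and `χ'`, which differ by `2 (n-1)` because `v_{n-1}^2` has that weight under `v_0`. It is the
matrix coefficient of the twisted action from `v_0 ⊗ v_0` to `v_{n-1} ⊗ v_{n-1}`, suitably scaled. -/
theorem exists_functionals [CharZero k] {n : ℕ} (hn : 2 ≤ n) (c : k) :
    ∃ φ : UniversalEnvelopingAlgebra k (g k n) →ₗ[k] k,
      (∀ a, φ (a * UniversalEnvelopingAlgebra.ι k (v k n (n - 1)) ^ 2)
        = character (by omega) (c + 2 * ((n - 1 : ℕ) : k)) a) ∧
      ∀ a, φ (UniversalEnvelopingAlgebra.ι k (v k n (n - 1)) ^ 2 * a)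
        = character (by omega) c a := by
  have hn1 : 1 ≤ n := by omega
  have hK : (2 * ((n - 1 : ℕ) : k) ^ 2) ≠ 0 :=
    mul_ne_zero two_ne_zero (pow_ne_zero _ (Nat.cast_ne_zero.2 (by omega)))
  obtain ⟨f, hf⟩ : ∃ f : Module.Dual k (g k n), f (v k n (n - 1)) = 1 :=
    Module.Projective.exists_dual_eq_one k (v_top_ne_zero hn1)
  let w : g k n ⊗[k] g k n := v k n 0 ⊗ₜ[k] v k n 0
  have hw : coeffZeroSq hn1 w = 1 := by
    simp only [w, coeffZeroSq_tmul, coeffZero_v, if_true, one_mul]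
  let l : g k n ⊗[k] g k n →ₗ[k] k := LinearMap.mul' k k ∘ₗ TensorProduct.map f f
  have hl : l (v k n (n - 1) ⊗ₜ[k] v k n (n - 1)) = 1 := by simp [l, hf]
  refine ⟨(2 * ((n - 1 : ℕ) : k) ^ 2)⁻¹ •
    (l ∘ₗ LinearMap.applyₗ w ∘ₗ (twistedAction hn1 c).toLinearMap), fun a => ?_, fun a => ?_⟩
  · change (2 * ((n - 1 : ℕ) : k) ^ 2)⁻¹ * l (twistedAction hn1 c (_ * _) w) = _
    rw [map_mul, Module.End.mul_apply, twistedAction_sq hn, hw, map_smul, twistedAction_top,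
      map_smul, map_smul, hl, smul_eq_mul, smul_eq_mul, mul_one, mul_one, ← mul_assoc,
      inv_mul_cancel₀ hK, one_mul]
  · change (2 * ((n - 1 : ℕ) : k) ^ 2)⁻¹ * l (twistedAction hn1 c (_ * _) w) = _
    rw [map_mul, Module.End.mul_apply, twistedAction_sq hn, coeffZeroSq_twistedAction, hw, map_smul,
      hl, smul_eq_mul, mul_one, mul_one, ← mul_assoc, inv_mul_cancel₀ hK, one_mul]

/-! ### Infinite-dimensional quotients of the Weyl algebra -/

/-- The algebra homomorphism out of the Weyl algebra determined by images of `t` and `∂`. -/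
def weylLift {A : Type*} [Ring A] [Algebra k A] (a b : A) (h : b * a - a * b = 1) :
    Weyl k →ₐ[k] A :=
  RingQuot.liftAlgHom k ⟨FreeAlgebra.lift k ![a, b], by
    rintro _ _ ⟨⟩
    simpa using h⟩

theorem weylLift_weylT {A : Type*} [Ring A] [Algebra k A] (a b : A) (h : b * a - a * b = 1) :
    weylLift a b h (weylT k) = a := by
  refine (RingQuot.liftAlgHom_mkAlgHom_apply k _ _ _).trans ?_
  simp

theorem weylLift_weylD {A : Type*} [Ring A] [Algebra k A] (a b : A) (h : b * a - a * b = 1) :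
    weylLift a b h (weylD k) = b := by
  refine (RingQuot.liftAlgHom_mkAlgHom_apply k _ _ _).trans ?_
  simp

/-- `A_1 / A_1 ∂` is infinite-dimensional: it is the natural module `k[t]`. -/
theorem exists_surjective_mul_weylD : ∃ π : Weyl k →ₗ[k] k[X],
    Function.Surjective π ∧ ∀ z, π (z * weylD k) = 0 := by
  let F : Weyl k →ₐ[k] Module.End k k[X] :=
    weylLift (LinearMap.mulLeft k Polynomial.X) Polynomial.derivative <| by
      refine LinearMap.ext fun p => ?_
      simp [Polynomial.derivative_mul]
  refine ⟨LinearMap.applyₗ 1 ∘ₗ F.toLinearMap, fun p => ⟨weylPoly p, ?_⟩, fun z => ?_⟩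
  · change F (weylPoly p) 1 = p
    rw [weylPoly, ← Polynomial.aeval_algHom_apply, weylLift_weylT]
    induction p using Polynomial.induction_on' with
    | add p q hp hq => rw [map_add, LinearMap.add_apply, hp, hq]
    | monomial m a =>
      rw [Polynomial.aeval_monomial, Module.End.mul_apply, LinearMap.pow_mulLeft,
        LinearMap.mulLeft_apply, mul_one, Module.algebraMap_end_apply, Polynomial.smul_eq_C_mul,
        Polynomial.C_mul_X_pow_eq_monomial]
  · change F (z * weylD k) 1 = 0
    rw [map_mul, weylLift_weylD, Module.End.mul_apply, Polynomial.derivative_one, map_zero]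

/-- `A_1 / ∂ A_1` is infinite-dimensional: it is `k[t]` as a right module, with `∂` acting by
`f ↦ -f'`. -/
theorem exists_surjective_weylD_mul : ∃ π : Weyl k →ₗ[k] k[X],
    Function.Surjective π ∧ ∀ z, π (weylD k * z) = 0 := by
  let F : Weyl k →ₐ[k] (Module.End k k[X])ᵐᵒᵖ :=
    weylLift (MulOpposite.op (LinearMap.mulLeft k Polynomial.X))
      (MulOpposite.op (-Polynomial.derivative)) <| by
      refine MulOpposite.unop_injective (LinearMap.ext fun p => ?_)
      simp [Polynomial.derivative_mul]
  refine ⟨LinearMap.applyₗ 1 ∘ₗ (MulOpposite.opLinearEquiv k).symm.toLinearMap ∘ₗ F.toLinearMap,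
    fun p => ⟨weylPoly p, ?_⟩, fun z => ?_⟩
  · change (F (weylPoly p)).unop 1 = p
    rw [weylPoly, ← Polynomial.aeval_algHom_apply, weylLift_weylT]
    induction p using Polynomial.induction_on' with
    | add p q hp hq => rw [map_add, MulOpposite.unop_add, LinearMap.add_apply, hp, hq]
    | monomial m a =>
      rw [Polynomial.aeval_monomial, MulOpposite.unop_mul, MulOpposite.unop_pow,
        MulOpposite.unop_op, Module.End.mul_apply, LinearMap.pow_mulLeft, LinearMap.mulLeft_apply,
        MulOpposite.algebraMap_apply, MulOpposite.unop_op, Module.algebraMap_end_apply,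
        mul_smul_comm, mul_one, Polynomial.smul_eq_C_mul, Polynomial.C_mul_X_pow_eq_monomial]
  · change (F (weylD k * z)).unop 1 = 0
    rw [map_mul, weylLift_weylD, MulOpposite.unop_mul, MulOpposite.unop_op, Module.End.mul_apply,
      LinearMap.neg_apply, Polynomial.derivative_one, neg_zero, map_zero]

/-! ### Failure of finite generation -/

/-- If `f` sends a left ideal `J` of a `k`-algebra onto an infinite-dimensional space and every
element of the algebra acts on the images by scalars, then `J` is not finitely generated. -/
theorem not_fg_of_smul_mem_span {A V : Type*} [Ring A] [Algebra k A] [AddCommGroup V]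
    [Module k V] (hV : ¬ Module.Finite k V) (J : Ideal A) (f : A →ₗ[k] V)
    (hf : ∀ a, ∀ x ∈ J, f (a * x) ∈ Submodule.span k {f x}) (hsurj : ∀ y, ∃ x ∈ J, f x = y) :
    ¬ J.FG := by
  rintro ⟨S, hS⟩
  refine hV ⟨Submodule.fg_def.2 ⟨f '' S, S.finite_toSet.image f, top_le_iff.1 fun y _ => ?_⟩⟩
  obtain ⟨x, hx, rfl⟩ := hsurj y
  rw [← hS] at hx hf
  induction hx using Submodule.span_induction with
  | mem x hx => exact Submodule.subset_span (Set.mem_image_of_mem f hx)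
  | zero => rw [map_zero]; exact Submodule.zero_mem _
  | add x y _ _ hx hy => rw [map_add]; exact Submodule.add_mem _ (hx trivial) (hy trivial)
  | smul a x hx h =>
    exact (Submodule.span_singleton_le_iff_mem _ _).2 (h trivial) (hf a x hx)

/-- The algebra homomorphism `T_n → A_1` that is the identity on `A_1` and sends `v_0` to `c`
and the other `v_i` to `0`. -/
def specialization {n : ℕ} (hn : 1 ≤ n) (c : k) : T k n →ₐ[k] Weyl k :=
  (Algebra.TensorProduct.rid k k (Weyl k)).toAlgHom.comp
    (Algebra.TensorProduct.map (AlgHom.id k _) (character hn c))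

theorem specialization_tmul {n : ℕ} (hn : 1 ≤ n) (c : k) (a : Weyl k)
    (u : UniversalEnvelopingAlgebra k (g k n)) :
    specialization hn c (a ⊗ₜ[k] u) = character hn c u • a := by
  simp [specialization]

/-- The specializations of `T_n` factor through right and left multiplication by `v_{n-1}^2`. -/
theorem exists_linearMap_T [CharZero k] {n : ℕ} (hn : 2 ≤ n) (c : k) :
    ∃ θ : T k n →ₗ[k] Weyl k,
      (∀ x, θ (x * vT k n (n - 1) ^ 2)
        = specialization (by omega) (c + 2 * ((n - 1 : ℕ) : k)) x) ∧
      ∀ x, θ (vT k n (n - 1) ^ 2 * x) = specialization (by omega) c x := by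
  obtain ⟨φ, h1, h2⟩ := exists_functionals hn c
  refine ⟨(TensorProduct.rid k (Weyl k)).toLinearMap ∘ₗ TensorProduct.map LinearMap.id φ,
    fun x => ?_, fun x => ?_⟩
  · induction x using TensorProduct.induction_on with
    | zero => simp
    | add x y hx hy => rw [add_mul, map_add, map_add, hx, hy]
    | tmul a u =>
      rw [specialization_tmul, ← h1]
      simp [vT, Algebra.TensorProduct.tmul_pow]
  · induction x using TensorProduct.induction_on with
    | zero => simp
    | add x y hx hy => rw [mul_add, map_add, map_add, hx, hy]
    | tmul a u =>
      rw [specialization_tmul, ← h2]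
      simp [vT, Algebra.TensorProduct.tmul_pow]

theorem psi_apply [CharZero k] (n : ℕ) (D : Witt k) : psi k n D = polyT n (D Polynomial.X) * dT k n
      + ∑ i ∈ Finset.range n, polyT n (Polynomial.hasseDeriv (i + 1) (D Polynomial.X))
          * vT k n i := psiLinear_apply n D

theorem specialization_psi [CharZero k] {n : ℕ} (hn : 1 ≤ n) (c : k) (D : Witt k) :
    specialization hn c (psi k n D) = weylPoly (D Polynomial.X) * weylD k
      + c • weylPoly (Polynomial.derivative (D Polynomial.X)) := by
  have hv (i : ℕ) : specialization hn c (vT k n i) = if i = 0 then algebraMap k _ c else 0 := by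
    rw [vT, specialization_tmul, character_ι, coeffZero_v]
    split_ifs
    · rw [mul_one, Algebra.algebraMap_eq_smul_one]
    · rw [mul_zero, zero_smul]
  have hp (f : k[X]) : specialization hn c (polyT n f) = weylPoly f := by
    rw [polyT, specialization_tmul, map_one, one_smul]
  have hd : specialization hn c (dT k n) = weylD k := by
    rw [dT, specialization_tmul, map_one, one_smul]
  rw [psi_apply, map_add, map_mul, map_sum, hp, hd, Finset.sum_eq_single 0]
  · rw [map_mul, hp, hv, if_pos rfl, ← Algebra.commutes, ← Algebra.smul_def, zero_add,
      Polynomial.hasseDeriv_one]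
  · intro i _ hi
    rw [map_mul, hv, if_neg hi, mul_zero]
  · intro h
    exact absurd (Finset.mem_range.2 hn) h

/-- The specialization `v_0 ↦ 0` sends `f ∂` to `f ∂`, hence `B_n` into `k + A_1 ∂`. -/
theorem specialization_zero_mem [CharZero k] {n : ℕ} (hn : 1 ≤ n) {x : T k n} (hx : x ∈ B k n) :
    ∃ (c : k) (z : Weyl k), specialization hn 0 x = algebraMap k _ c + z * weylD k := by
  obtain ⟨u, rfl⟩ := hx
  have hu : u ∈ Algebra.adjoin k (Set.range (UniversalEnvelopingAlgebra.ι k : Witt k →ₗ⁅k⁆ _)) :=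
    adjoin_range_universalEnveloping_ι k (Witt k) ▸ Algebra.mem_top
  change ∃ (c : k) (z : Weyl k), specialization hn 0 (Psi k n u) = _
  induction hu using Algebra.adjoin_induction with
  | mem u hu =>
    obtain ⟨D, rfl⟩ := hu
    refine ⟨0, weylPoly (D Polynomial.X), ?_⟩
    rw [Psi, UniversalEnvelopingAlgebra.lift_ι_apply, specialization_psi, zero_smul, map_zero,
      add_zero, zero_add]
  | algebraMap c => exact ⟨c, 0, by simp only [AlgHom.commutes, zero_mul, add_zero]⟩
  | add u u' _ _ h h' =>
    obtain ⟨c, z, h⟩ := h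
    obtain ⟨c', z', h'⟩ := h'
    exact ⟨c + c', z + z', by rw [map_add, map_add, h, h', map_add, add_mul]; abel⟩
  | mul u u' _ _ h h' =>
    obtain ⟨c, z, h⟩ := h
    obtain ⟨c', z', h'⟩ := h'
    refine ⟨c * c', (algebraMap k _ c + z * weylD k) * z' + c' • z, ?_⟩
    rw [map_mul, map_mul, h, h', mul_add, add_mul _ _ (algebraMap k _ c'), ← map_mul,
      ← Algebra.commutes c', ← Algebra.smul_def, add_mul _ (c' • z),
      smul_mul_assoc, mul_assoc _ z', add_mul]
    abel

/-- The specialization `v_0 ↦ 1` sends `f ∂` to `f ∂ + f' = ∂ f`, hence `B_n` into `k + ∂ A_1`. -/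
theorem specialization_one_mem [CharZero k] {n : ℕ} (hn : 1 ≤ n) {x : T k n} (hx : x ∈ B k n) :
    ∃ (c : k) (z : Weyl k), specialization hn 1 x = algebraMap k _ c + weylD k * z := by
  obtain ⟨u, rfl⟩ := hx
  have hu : u ∈ Algebra.adjoin k (Set.range (UniversalEnvelopingAlgebra.ι k : Witt k →ₗ⁅k⁆ _)) :=
    adjoin_range_universalEnveloping_ι k (Witt k) ▸ Algebra.mem_top
  change ∃ (c : k) (z : Weyl k), specialization hn 1 (Psi k n u) = _
  induction hu using Algebra.adjoin_induction with
  | mem u hu =>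
    obtain ⟨D, rfl⟩ := hu
    refine ⟨0, weylPoly (D Polynomial.X), ?_⟩
    rw [Psi, UniversalEnvelopingAlgebra.lift_ι_apply, specialization_psi, one_smul, map_zero,
      zero_add, weylD_mul_poly]
  | algebraMap c => exact ⟨c, 0, by simp only [AlgHom.commutes, mul_zero, add_zero]⟩
  | add u u' _ _ h h' =>
    obtain ⟨c, z, h⟩ := h
    obtain ⟨c', z', h'⟩ := h'
    exact ⟨c + c', z + z', by rw [map_add, map_add, h, h', map_add, mul_add]; abel⟩
  | mul u u' _ _ h h' =>
    obtain ⟨c, z, h⟩ := h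
    obtain ⟨c', z', h'⟩ := h'
    refine ⟨c * c', z * (algebraMap k _ c' + weylD k * z') + c • z', ?_⟩
    rw [map_mul, map_mul, h, h', add_mul, mul_add (algebraMap k _ c), ← map_mul,
      ← Algebra.smul_def, mul_add (weylD k), mul_smul_comm, ← mul_assoc (weylD k) z]
    abel

/-- `x v_{n-1}^2 ↦ x` induces a map onto `A_1 / ∂ A_1` on which `B_n` acts from the left by
scalars. -/
theorem not_fg_left [CharZero k] {n : ℕ} (hn : 2 ≤ n) (J : Ideal (B k n))
    (hJ : Subtype.val '' (J : Set (B k n))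
      = (Ideal.span {vT k n (n - 1) ^ 2} : Ideal (T k n))) : ¬ J.FG := by
  obtain ⟨θ, hθ, -⟩ := exists_linearMap_T (k := k) hn (1 - 2 * ((n - 1 : ℕ) : k))
  -- The twist is chosen so that `v_0` specializes to `1`.
  rw [sub_add_cancel] at hθ
  obtain ⟨π, hπ, hπ0⟩ := exists_surjective_weylD_mul (k := k)
  refine not_fg_of_smul_mem_span Polynomial.not_finite J
    (π ∘ₗ θ ∘ₗ (B k n).val.toLinearMap) (fun b x hx => ?_) fun y => ?_
  · have hx' := hJ.subset (Set.mem_image_of_mem _ hx)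
    obtain ⟨a, ha⟩ := Ideal.mem_span_singleton'.1 hx'
    obtain ⟨c, z, hb⟩ := specialization_one_mem (show 1 ≤ n by omega) b.2
    refine Submodule.mem_span_singleton.2 ⟨c, ?_⟩
    change c • π (θ x) = π (θ (b * x))
    rw [← ha, ← mul_assoc, hθ, hθ, map_mul, hb, add_mul, map_add, mul_assoc (weylD k), hπ0,
      add_zero, ← Algebra.smul_def, map_smul]
  · obtain ⟨a, rfl⟩ := hπ y
    obtain ⟨x, hx, hxa⟩ := hJ.superset (Ideal.mem_span_singleton'.2 ⟨a ⊗ₜ[k] 1, rfl⟩)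
    refine ⟨x, hx, ?_⟩
    change π (θ x) = π a
    rw [hxa, hθ, specialization_tmul, map_one, one_smul]

/-- `v_{n-1}^2 x ↦ x` induces a map onto `A_1 / A_1 ∂` on which `B_n` acts from the right by
scalars. -/
theorem not_fg_right [CharZero k] {n : ℕ} (hn : 2 ≤ n) (J : Ideal (B k n)ᵐᵒᵖ)
    (hJ : (fun x => (x.unop : T k n)) '' (J : Set (B k n)ᵐᵒᵖ)
      = (Ideal.span {vT k n (n - 1) ^ 2} : Ideal (T k n))) : ¬ J.FG := by
  obtain ⟨θ, -, hθ⟩ := exists_linearMap_T (k := k) hn 0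
  obtain ⟨π, hπ, hπ0⟩ := exists_surjective_mul_weylD (k := k)
  refine not_fg_of_smul_mem_span Polynomial.not_finite J
    (π ∘ₗ θ ∘ₗ (B k n).val.toLinearMap ∘ₗ (MulOpposite.opLinearEquiv k).symm.toLinearMap)
    (fun b x hx => ?_) fun y => ?_
  · have hx' := hJ.subset (Set.mem_image_of_mem _ hx)
    obtain ⟨a', ha'⟩ := Ideal.mem_span_singleton'.1 hx'
    obtain ⟨a, ha⟩ := exists_mul_sq_eq a'
    rw [ha] at ha'
    obtain ⟨c, z, hb⟩ := specialization_zero_mem (show 1 ≤ n by omega) b.unop.2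
    refine Submodule.mem_span_singleton.2 ⟨c, ?_⟩
    change c • π (θ x.unop) = π (θ (x.unop * b.unop))
    rw [← ha', mul_assoc, hθ, hθ, map_mul, hb, mul_add, map_add, ← mul_assoc, hπ0,
      add_zero, ← Algebra.commutes, ← Algebra.smul_def, map_smul]
  · obtain ⟨a, rfl⟩ := hπ y
    obtain ⟨a', ha'⟩ := exists_sq_mul_eq (n := n) (a ⊗ₜ[k] 1)
    obtain ⟨x, hx, hxa⟩ := hJ.superset (Ideal.mem_span_singleton'.2 ⟨a', rfl⟩)
    refine ⟨x, hx, ?_⟩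
    change π (θ x.unop) = π a
    rw [← ha'] at hxa
    rw [show (x.unop : T k n) = _ from hxa, hθ, specialization_tmul, map_one, one_smul]

/-- As a subset of `T_n`, the two-sided ideal `B_n v_{n-1}^2 B_n` is all of `T_n v_{n-1}^2`. -/
theorem image_span_eq [CharZero k] {n : ℕ} (hn : 2 ≤ n) (b : B k n)
    (hb : (b : T k n) = vT k n (n - 1) ^ 2) :
    Subtype.val '' (TwoSidedIdeal.span {b} : Set (B k n))
      = (Ideal.span {vT k n (n - 1) ^ 2} : Ideal (T k n)) := by
  refine Set.Subset.antisymm ?_ ?_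
  · rw [span_sq_eq_twoSidedIdeal_span]
    rintro _ ⟨x, hx, rfl⟩
    have hle : TwoSidedIdeal.span {b} ≤ TwoSidedIdeal.comap (B k n).val
        (TwoSidedIdeal.span {vT k n (n - 1) ^ 2}) := by
      rw [TwoSidedIdeal.span_le, Set.singleton_subset_iff, SetLike.mem_coe,
        TwoSidedIdeal.mem_comap]
      exact TwoSidedIdeal.subset_span hb
    exact (TwoSidedIdeal.mem_comap _).1 (hle hx)
  · intro x hx
    obtain ⟨a, rfl⟩ := Ideal.mem_span_singleton'.1 hx
    have hpsi (D : Witt k) : psi k n D ∈ B k n :=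
      ⟨UniversalEnvelopingAlgebra.ι k D, UniversalEnvelopingAlgebra.lift_ι_apply k (psi k n) D⟩
    let M : Submodule k (T k n) :=
      ((TwoSidedIdeal.span {b}).asIdeal.restrictScalars k).map (B k n).val.toLinearMap
    refine mul_sq_mem hn M ?_ ?_ ⟨b, TwoSidedIdeal.subset_span rfl, hb⟩ a
    · rintro D _ ⟨y, hy, rfl⟩
      exact ⟨⟨psi k n D, hpsi D⟩ * y, TwoSidedIdeal.mem_asIdeal.2
        (TwoSidedIdeal.mul_mem_left _ _ _ (TwoSidedIdeal.mem_asIdeal.1 hy)), rfl⟩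
    · rintro D _ ⟨y, hy, rfl⟩
      exact ⟨y * ⟨psi k n D, hpsi D⟩, TwoSidedIdeal.mem_asIdeal.2
        (TwoSidedIdeal.mul_mem_right _ _ _ (TwoSidedIdeal.mem_asIdeal.1 hy)), rfl⟩

end OrbitHom

end

theorem theorem1p1 (k : Type*) [Field k] [CharZero k] (n : ℕ) (hn : 2 ≤ n) :
    -- the image of the differentiator is a nonzero scalar multiple of `v_{n-1}^2`
    (∃ c : k, c ≠ 0 ∧
      OrbitHom.Psi k n (OrbitHom.differentiator k (2 * n) (2 * n - 1) (-1))
        = c • OrbitHom.vT k n (n - 1) ^ 2) ∧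
    -- the left ideal `T_n v_{n-1}^2` is the two-sided ideal of `T_n` generated by `v_{n-1}^2`
    ((Ideal.span {OrbitHom.vT k n (n - 1) ^ 2} : Ideal (OrbitHom.T k n)) : Set (OrbitHom.T k n))
      = TwoSidedIdeal.span {OrbitHom.vT k n (n - 1) ^ 2} ∧
    -- it is contained in `B_n`
    ((Ideal.span {OrbitHom.vT k n (n - 1) ^ 2} : Ideal (OrbitHom.T k n)) : Set (OrbitHom.T k n))
      ⊆ OrbitHom.B k n ∧
    -- it is a two-sided ideal `J` of `B_n`, principal with generator `v_{n-1}^2`, and finitely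
    -- generated neither as a left ideal nor as a right ideal of `B_n`
    ∃ J : TwoSidedIdeal (OrbitHom.B k n),
      (Subtype.val '' (J : Set (OrbitHom.B k n))
        = (Ideal.span {OrbitHom.vT k n (n - 1) ^ 2} : Ideal (OrbitHom.T k n))) ∧
      (∃ b : OrbitHom.B k n, (b : OrbitHom.T k n) = OrbitHom.vT k n (n - 1) ^ 2 ∧
        J = TwoSidedIdeal.span {b}) ∧
      ¬ (TwoSidedIdeal.asIdeal J).FG ∧
      ¬ (TwoSidedIdeal.asIdealOpposite J).FG := by
  have hc : ((-1) ^ n * ((2 * n).choose n : k)) ≠ 0 :=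
    mul_ne_zero (pow_ne_zero _ (neg_ne_zero.2 one_ne_zero))
      (Nat.cast_ne_zero.2 (Nat.choose_pos (by omega)).ne')
  have hΩ := OrbitHom.Psi_differentiator (k := k) hn
  have hmem : OrbitHom.vT k n (n - 1) ^ 2 ∈ OrbitHom.B k n := by
    have h : _ ∈ OrbitHom.B k n := AlgHom.mem_range_self (OrbitHom.Psi k n)
      (OrbitHom.differentiator k (2 * n) (2 * n - 1) (-1))
    have h' := (OrbitHom.B k n).smul_mem h ((-1) ^ n * ((2 * n).choose n : k))⁻¹
    rwa [hΩ, smul_smul, inv_mul_cancel₀ hc, one_smul] at h'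
  have hJ := OrbitHom.image_span_eq hn ⟨_, hmem⟩ rfl
  refine ⟨⟨_, hc, hΩ⟩, OrbitHom.span_sq_eq_twoSidedIdeal_span n, ?_, _, hJ, ⟨_, rfl, rfl⟩,
    OrbitHom.not_fg_left hn _ hJ, OrbitHom.not_fg_right hn _ ?_⟩
  · rw [← hJ]
    rintro _ ⟨x, -, rfl⟩
    exact x.2
  · rw [← hJ]
    ext x
    constructor
    · rintro ⟨y, hy, rfl⟩
      exact ⟨y.unop, TwoSidedIdeal.mem_asIdealOpposite.1 hy, rfl⟩
    · rintro ⟨y, hy, rfl⟩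
      exact ⟨MulOpposite.op y, TwoSidedIdeal.mem_asIdealOpposite.2 hy, rfl⟩
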